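/- Let $p\in(10/3,6)$ and $c>0$. Let $H^1(\mathbb{R}^3)$ be the Sobolev space of complex-valued functions, with norm $\|u\|^2=\int|\nabla u|^2+\int|u|^2$, and write $(u,v)_2=\int_{\mathbb{R}^3}u\,\bar v\,dx$. For $u\in H^1(\mathbb{R}^3)$ put $$F(u)=\frac12\int_{\mathbb{R}^3}|\nabla u|^2dx+\frac14\iint_{\mathbb{R}^3\times\mathbb{R}^3}\frac{|u(x)|^2|u(y)|^2}{|x-y|}\,dx\,dy-\frac1p\int_{\mathbb{R}^3}|u|^p\,dx,$$ $$Q(u)=\int_{\mathbb{R}^3}|\nabla u|^2dx+\frac14\iint_{\mathbb{R}^3\times\mathbb{R}^3}\frac{|u(x)|^2|u(y)|^2}{|x-y|}\,dx\,dy-\frac{3(p-2)}{2p}\int_{\mathbb{R}^3}|u|^p\,dx,$$ and let $S(c)=\{u\in H^1(\mathbb{R}^3):\int|u|^2=c\}$ and $V(c)=\{u\in S(c):Q(u)=0\}$. Let $u_c$ be a minimizer of $F$ on $V(c)$, that is, $u_c\in V(c)$ and $F(u_c)=\inf_{u\in V(c)}F(u)$. Then $u_c$ is a critical point of $F$ restricted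 to $S(c)$: $F$ is Fréchet differentiable at $u_c$ on the real normed space $H^1(\mathbb{R}^3)$, and $F'(u_c)v=0$ for every $v\in H^1(\mathbb{R}^3)$ with $\operatorname{Re}(u_c,v)_2=0$. Moreover there is a real number $\lambda_c\le 0$ (the Lagrange multiplier) such that $F'(u_c)v=\lambda_c\operatorname{Re}(u_c,v)_2$ for all $v\in H^1(\mathbb{R}^3)$, and $(u_c,\lambda_c)$ is a weak solution of $$-\Delta u-\lambda u+(|x|^{-1}*|u|^2)\,u-|u|^{p-2}u=0\quad\text{in }\mathbb{R}^3,$$ that is, for every $v\in H^1(\mathbb{R}^3)$ the integrals below converge absolutely and $$\int\nabla u_c\cdot\overline{\nabla v}\,dx-\lambda_c\int u_c\,\bar v\,dx+\int(|x|^{-1}*|u_c|^2)\,u_c\,\bar v\,dx-\int|u_c|^{p-2}u_c\,\bar v\,dx=0.$$ -/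

import Mathlib

open MeasureTheory
open scoped ContDiff ComplexConjugate

namespace SPS

/-- Physical space `ℝ³`, with its Euclidean norm and Lebesgue measure. -/
abbrev E3 : Type := EuclideanSpace ℝ (Fin 3)

/-- Complex-valued `L²(ℝ³)`. -/
abbrev L2 : Type := Lp ℂ 2 (volume : Measure E3)

/-- `L²(ℝ³; ℂ³)`, the space in which gradients live. -/
abbrev L2vec : Type := Lp (EuclideanSpace ℂ (Fin 3)) 2 (volume : Measure E3)

/-- `g` is the weak gradient of `u`: `∫ (∂ᵢφ) u = - ∫ φ gᵢ` for all `φ ∈ C_c^∞(ℝ³)` and all `i`.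
Real test functions suffice, by linearity. -/
def HasWeakGradient (u : L2) (g : L2vec) : Prop :=
  ∀ φ : E3 → ℝ, ContDiff ℝ ∞ φ → HasCompactSupport φ → ∀ i : Fin 3,
    ∫ x, (fderiv ℝ φ x (EuclideanSpace.single i 1)) • u x = - ∫ x, φ x • (g x) i

theorem integrable_test_smul {ψ : E3 → ℝ} (hψ : Continuous ψ) (hc : HasCompactSupport ψ)
    (f : E3 → ℂ) (hf : MemLp f 2 volume) : Integrable (fun x => ψ x • f x) volume :=
  memLp_one_iff_integrable.1
    (MemLp.smul (p := 2) (q := 2) (r := 1) hf (hψ.memLp_of_hasCompactSupport hc))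

theorem memLp_component (g : L2vec) (i : Fin 3) : MemLp (fun x => (g x) i) 2 volume :=
  (EuclideanSpace.proj (𝕜 := ℂ) i : EuclideanSpace ℂ (Fin 3) →L[ℂ] ℂ).comp_memLp' (Lp.memLp g)

theorem integrable_fderiv_smul {φ : E3 → ℝ} (h : ContDiff ℝ ∞ φ) (hc : HasCompactSupport φ)
    (i : Fin 3) (u : L2) :
    Integrable (fun x => (fderiv ℝ φ x (EuclideanSpace.single i 1)) • u x) volume :=
  integrable_test_smul ((h.continuous_fderiv (by simp)).clm_apply continuous_const)
    (hc.fderiv_apply ℝ _) _ (Lp.memLp u)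

/-- The Sobolev space `H¹(ℝ³)` of complex-valued functions: the `u ∈ L²` with a weak gradient in
`L²`. An element is stored as the pair `(u, ∇u)` (the weak gradient is determined by `u`), and the
norm inherited from the `ℓ²`-product is `‖u‖² = ∫ |u|² + ∫ |∇u|²`. -/
noncomputable def H1 : Submodule ℂ (WithLp 2 (L2 × L2vec)) where
  carrier := {w | HasWeakGradient w.fst w.snd}
  zero_mem' := by
    intro φ _ _ i
    simp
  add_mem' := by
    intro a b ha hb φ hφ hc i
    have h1 : (fun x => (fderiv ℝ φ x (EuclideanSpace.single i 1)) • (a.fst + b.fst : L2) x)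
        =ᵐ[volume] fun x => (fderiv ℝ φ x (EuclideanSpace.single i 1)) • a.fst x
          + (fderiv ℝ φ x (EuclideanSpace.single i 1)) • b.fst x := by
      filter_upwards [Lp.coeFn_add a.fst b.fst] with x hx
      rw [hx, Pi.add_apply, smul_add]
    have h2 : (fun x => φ x • ((a.snd + b.snd : L2vec) x) i)
        =ᵐ[volume] fun x => φ x • (a.snd x) i + φ x • (b.snd x) i := by
      filter_upwards [Lp.coeFn_add a.snd b.snd] with x hx
      rw [hx, Pi.add_apply, PiLp.add_apply, smul_add]
    simp only [WithLp.add_fst, WithLp.add_snd]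
    rw [integral_congr_ae h1, integral_congr_ae h2,
      integral_add (integrable_fderiv_smul hφ hc i _) (integrable_fderiv_smul hφ hc i _),
      integral_add (integrable_test_smul hφ.continuous hc _ (memLp_component _ i))
        (integrable_test_smul hφ.continuous hc _ (memLp_component _ i)),
      ha φ hφ hc i, hb φ hφ hc i, neg_add]
  smul_mem' := by
    intro z a ha φ hφ hc i
    have h1 : (fun x => (fderiv ℝ φ x (EuclideanSpace.single i 1)) • (z • a.fst : L2) x)
        =ᵐ[volume] fun x => z • ((fderiv ℝ φ x (EuclideanSpace.single i 1)) • a.fst x) := by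
      filter_upwards [Lp.coeFn_smul z a.fst] with x hx
      rw [hx, Pi.smul_apply, smul_comm]
    have h2 : (fun x => φ x • ((z • a.snd : L2vec) x) i)
        =ᵐ[volume] fun x => z • (φ x • (a.snd x) i) := by
      filter_upwards [Lp.coeFn_smul z a.snd] with x hx
      rw [hx, Pi.smul_apply, PiLp.smul_apply, smul_comm]
    simp only [WithLp.smul_fst, WithLp.smul_snd]
    rw [integral_congr_ae h1, integral_congr_ae h2, integral_smul, integral_smul,
      ha φ hφ hc i, smul_neg]

/-- The function underlying `u ∈ H¹(ℝ³)` (an a.e. representative). -/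
noncomputable def fn (u : H1) : E3 → ℂ := u.1.fst

/-- The weak gradient `∇u` of `u ∈ H¹(ℝ³)` (an a.e. representative). -/
noncomputable def grad (u : H1) : E3 → EuclideanSpace ℂ (Fin 3) := u.1.snd

/-- `‖u‖²` in `L²(ℝ³)`. -/
noncomputable def mass (u : H1) : ℝ := ∫ x, ‖fn u x‖ ^ 2

/-- `‖∇u‖²` in `L²(ℝ³)`. -/
noncomputable def kinetic (u : H1) : ℝ := ∫ x, ‖grad u x‖ ^ 2

/-- `|x|⁻¹ * |u|²`. -/
noncomputable def potential (u : H1) (x : E3) : ℝ := ∫ y, ‖fn u y‖ ^ 2 / ‖x - y‖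

/-- `∬ |u(x)|² |u(y)|² / |x - y| dx dy`. -/
noncomputable def coulomb (u : H1) : ℝ := ∫ x, ∫ y, ‖fn u x‖ ^ 2 * ‖fn u y‖ ^ 2 / ‖x - y‖

/-- `∫ |u|^p`. -/
noncomputable def power (p : ℝ) (u : H1) : ℝ := ∫ x, ‖fn u x‖ ^ p

/-- The energy functional `F`. -/
noncomputable def F (p : ℝ) (u : H1) : ℝ :=
  1 / 2 * kinetic u + 1 / 4 * coulomb u - 1 / p * power p u

/-- The functional `Q`. -/
noncomputable def Q (p : ℝ) (u : H1) : ℝ :=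
  kinetic u + 1 / 4 * coulomb u - 3 * (p - 2) / (2 * p) * power p u

/-- The mass constraint `S(c)`. -/
def S (c : ℝ) : Set H1 := {u | mass u = c}

/-- `V(c) = {u ∈ S(c) : Q(u) = 0}`. -/
def V (p c : ℝ) : Set H1 := {u | u ∈ S c ∧ Q p u = 0}

/-- The set of minimizers of `F` on `V(c)`. -/
def minimizers (p c : ℝ) : Set H1 := {u | u ∈ V p c ∧ IsMinOn (F p) (V p c) u}

/-- The real `L²` inner product `Re ∫ u v̄`. -/
noncomputable def reInner (u v : H1) : ℝ := (∫ x, fn u x * conj (fn v x)).re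

/-- `u` is a critical point of `F` restricted to `S(c)`: `F` is Fréchet differentiable at `u` on the
real normed space `H¹`, and its differential vanishes on the tangent space
`{v ∈ H¹ : Re (u, v)₂ = 0}` of `S(c)` at `u`. -/
def IsConstrainedCriticalPoint (p c : ℝ) (u : H1) : Prop :=
  u ∈ S c ∧ DifferentiableAt ℝ (F p) u ∧ ∀ v : H1, reInner u v = 0 → fderiv ℝ (F p) u v = 0

/-- `l` is a Lagrange multiplier of `F` at `u` for the mass constraint: `F'(u) = l u` in the dual
of `H¹`. -/
def IsLagrangeMultiplier (p : ℝ) (u : H1) (l : ℝ) : Prop :=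
  DifferentiableAt ℝ (F p) u ∧ ∀ v : H1, fderiv ℝ (F p) u v = l * reInner u v

/-- `(u, l)` solves `-Δu - l u + (|x|⁻¹ * |u|²) u - |u|^(p-2) u = 0` in `ℝ³`, weakly, that is as an
identity in the dual of `H¹`; all terms of the weak formulation are required to be integrable. -/
def IsWeakSolution (p : ℝ) (u : H1) (l : ℝ) : Prop :=
  ∀ v : H1,
    Integrable (fun x => ∑ i, grad u x i * conj (grad v x i)) ∧
    Integrable (fun x => fn u x * conj (fn v x)) ∧
    Integrable (fun x => (potential u x : ℂ) * fn u x * conj (fn v x)) ∧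
    Integrable (fun x => ((‖fn u x‖ ^ (p - 2) : ℝ) : ℂ) * fn u x * conj (fn v x)) ∧
    (∫ x, ∑ i, grad u x i * conj (grad v x i))
      - (l : ℂ) * (∫ x, fn u x * conj (fn v x))
      + (∫ x, (potential u x : ℂ) * fn u x * conj (fn v x))
      - (∫ x, ((‖fn u x‖ ^ (p - 2) : ℝ) : ℂ) * fn u x * conj (fn v x)) = 0

end SPS

namespace SPS

open Filter Topology Convolution
open scoped ENNReal NNReal

/-! Write `u_t = t^{3/2} u(t ·)`, which preserves the mass. With `A`, `B`, `C` the kinetic, Coulomb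
and power terms, `F(u_t)` and `Q(u_t)` are the explicit functions `fiberF` and `fiberQ` of `t`, with
power exponent `s = 3(p-2)/2 > 2`; this is where `p > 10/3` enters. If `Q(u) = 0`, then `t = 1`
maximizes `F(u_t)` (`fiberF_le_of_fiberQ_eq_zero`), and a root of `fiberQ` is a strict change of
sign, hence survives small changes of `A`, `B`, `C` (`eventually_exists_fiberQ_eq_zero`).

This replaces a second Lagrange multiplier for `Q = 0`. Let a curve `γ` leave the minimizer `u` in a
direction with `F'(u)v < 0`. For small `s > 0` some `t` near 1 puts `γ(s)_t` on `Q = 0`, and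
`F(γ(s)_t) < F(u_t) ≤ F(u)`, since the first-order decrease persists for `t` near 1
(`eventually_exists_fiberF_lt`). If `γ(s)` has mass `c` this contradicts minimality. Applied to `v`
and `-v`, with `u + s v` normalized, it gives `F'(u)v = 0` on the tangent space.

For the sign of the multiplier, mass at most `c` is enough (`le_fiberF_of_mass_le`): the missing
mass is supplied by a multiple of `u_ε` with `ε → 0`, whose kinetic and power terms and potential
tend to zero. So `(1-s)u` is an admissible curve, `F'(u)(-u) ≥ 0`, and the multiplier `F'(u)u / c`
is nonpositive.

The analytic input is differentiability of `F` on `H¹`. It rests on the embedding in `L⁶`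
(`exists_eLpNorm_six_le`), on the uniform bound for the Newtonian potential (`exists_potential_le`),
and on quadratic remainder estimates for the Coulomb and power terms. The complex weak equation
follows from its real part, tested with `v` and `i v`. -/

/-! ### Energy and constraint along dilations -/

/-- `F` along the mass-preserving dilations `t ↦ t^{3/2} u(t ·)`, in terms of the kinetic,
Coulomb and power terms `A`, `B`, `C` of `u`. -/
noncomputable def fiberF (p A B C t : ℝ) : ℝ :=
  1 / 2 * (t ^ 2 * A) + 1 / 4 * (t * B) - 1 / p * (t ^ (3 * (p - 2) / 2) * C)

/-- `Q` along the mass-preserving dilations. -/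
noncomputable def fiberQ (p A B C t : ℝ) : ℝ :=
  t ^ 2 * A + 1 / 4 * (t * B) - 3 * (p - 2) / (2 * p) * (t ^ (3 * (p - 2) / 2) * C)

/-- The condition at `1` eliminates `C`. The difference of the two energies is then a nonnegative
combination of two Bernoulli defects, those of `t ^ s` as a power of `t ^ 2` (exponent `s / 2 ≥ 1`)
and as a power of `t`. -/
theorem fiberF_le_of_fiberQ_eq_zero {p A B C t : ℝ} (hp : 10 / 3 < p) (hA : 0 ≤ A) (hB : 0 ≤ B)
    (ht : 0 < t) (hq : fiberQ p A B C 1 = 0) : fiberF p A B C t ≤ fiberF p A B C 1 := by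
  have hp0 : 0 < p := by linarith
  set s := 3 * (p - 2) / 2 with hs
  have hs2 : 2 < s := by rw [hs]; linarith
  have hs0 : 0 < s := by linarith
  have hC : 1 / p * C = (A + B / 4) / s := by
    have : 3 * (p - 2) / (2 * p) = s / p := by rw [hs]; field_simp
    simp only [fiberQ, this, Real.one_rpow] at hq
    field_simp at hq ⊢
    linarith
  have h1 : 1 + s / 2 * (t ^ 2 - 1) ≤ t ^ s := by
    have := one_add_mul_self_le_rpow_one_add (s := t ^ 2 - 1) (by nlinarith)
      (p := s / 2) (by linarith)
    refine this.trans_eq ?_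
    rw [add_sub_cancel, ← Real.rpow_natCast, ← Real.rpow_mul ht.le]
    congr 1
    push_cast
    ring
  have h2 : 1 + s * (t - 1) ≤ t ^ s := by
    have := one_add_mul_self_le_rpow_one_add (s := t - 1) (by linarith) (p := s) (by linarith)
    rwa [add_sub_cancel] at this
  have e : fiberF p A B C 1 - fiberF p A B C t
      = A / s * (t ^ s - (1 + s / 2 * (t ^ 2 - 1)))
        + B / (4 * s) * (t ^ s - (1 + s * (t - 1))) := by
    have : fiberF p A B C 1 - fiberF p A B C t
      = (1 / 2 * (1 ^ 2 * A) + 1 / 4 * (1 * B)) - (1 / 2 * (t ^ 2 * A) + 1 / 4 * (t * B))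
        + (t ^ s - 1) * (1 / p * C) := by
      simp only [fiberF, Real.one_rpow, ← hs]; ring
    rw [this, hC]
    field_simp
    ring
  have := mul_nonneg (div_nonneg hA hs0.le) (sub_nonneg.2 h1)
  have := mul_nonneg (div_nonneg hB (by positivity : 0 ≤ 4 * s)) (sub_nonneg.2 h2)
  linarith

/-- With `t = t₀ r`, `b = t₀ B / 4` and `Z > 0` the power term at the root, the value at `t` is `(r²
- r^s) Z + (r - r²) b`, and `r^s < r² < r` for `0 < r < 1`. -/
theorem fiberQ_pos_of_lt {p A B C t₀ t : ℝ} (hp : 10 / 3 < p) (hB : 0 ≤ B)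
    (hC : 0 < C) (ht : 0 < t) (h : t < t₀) (hq : fiberQ p A B C t₀ = 0) :
    0 < fiberQ p A B C t := by
  have ht₀ : 0 < t₀ := ht.trans h
  obtain ⟨r, rfl⟩ : ∃ r, t = t₀ * r := ⟨t / t₀, by field_simp⟩
  have hr : 0 < r := pos_of_mul_pos_right ht ht₀.le
  have hr1 : r < 1 := by nlinarith
  set s := 3 * (p - 2) / 2 with hs
  have hs2 : 2 < s := by rw [hs]; linarith
  have hp0 : 0 < p := by linarith
  set Z := 3 * (p - 2) / (2 * p) * (t₀ ^ s * C) with hZ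
  have hZ0 : 0 < Z := mul_pos (div_pos (by linarith) (by linarith)) (by positivity)
  have e1 : t₀ ^ 2 * A + 1 / 4 * (t₀ * B) = Z := by
    simp only [fiberQ, ← hs, ← hZ] at hq; linarith
  have e2 : fiberQ p A B C (t₀ * r)
      = r ^ 2 * (t₀ ^ 2 * A) + r * (1 / 4 * (t₀ * B)) - r ^ s * Z := by
    simp only [fiberQ, ← hs, Real.mul_rpow ht₀.le hr.le]
    rw [hZ]
    ring
  have h1 : r ^ s < r ^ 2 := by
    rw [← Real.rpow_natCast]
    exact Real.rpow_lt_rpow_of_exponent_gt hr hr1 (by exact_mod_cast hs2)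
  have h2 : r ^ 2 ≤ r := by nlinarith
  rw [e2]
  have h3 := mul_nonneg (sub_nonneg.2 h2) (by positivity : 0 ≤ 1 / 4 * (t₀ * B))
  have h4 := mul_pos (sub_pos.2 h1) hZ0
  rw [← e1] at h4 ⊢
  linarith

/-- Reduces to `fiberQ_pos_of_lt`. A nonnegative value at `t` becomes a root at `t` once `C` is
suitably enlarged, which forces a positive value at `t₀`; but enlarging `C` only lowers the value
there, which was zero. -/
theorem fiberQ_neg_of_gt {p A B C t₀ t : ℝ} (hp : 10 / 3 < p) (hB : 0 ≤ B)
    (hC : 0 < C) (ht₀ : 0 < t₀) (h : t₀ < t) (hq : fiberQ p A B C t₀ = 0) :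
    fiberQ p A B C t < 0 := by
  by_contra hcon
  rcases (not_lt.1 hcon).lt_or_eq with h0 | h0
  · -- a root of a larger coefficient `C` would lie between
    have hp0 : 0 < p := by linarith
    have ht : 0 < t := ht₀.trans h
    set k := 3 * (p - 2) / (2 * p) * (t ^ (3 * (p - 2) / 2)) with hk
    have hk0 : 0 < k := mul_pos (div_pos (by linarith) (by linarith)) (by positivity)
    set C' := C + fiberQ p A B C t / k with hC'
    have hCC : C < C' := by rw [hC']; linarith [div_pos h0 hk0]
    have h1 : fiberQ p A B C' t = 0 := by
      have : fiberQ p A B C' t = fiberQ p A B C t - k * (C' - C) := by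
        simp only [fiberQ, hk]; ring
      rw [this, hC', add_sub_cancel_left]
      field_simp
      ring
    have h2 := fiberQ_pos_of_lt hp hB (hC.trans hCC) ht₀ h h1
    have h3 : fiberQ p A B C' t₀ = fiberQ p A B C t₀
        - 3 * (p - 2) / (2 * p) * (t₀ ^ (3 * (p - 2) / 2)) * (C' - C) := by
      simp only [fiberQ]; ring
    have h4 : 0 < 3 * (p - 2) / (2 * p) * (t₀ ^ (3 * (p - 2) / 2)) * (C' - C) :=
      mul_pos (mul_pos (div_pos (by linarith) (by linarith)) (by positivity)) (by linarith)
    linarith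
  · have := fiberQ_pos_of_lt hp hB hC ht₀ h h0.symm
    linarith

theorem continuous_fiberQ {p : ℝ} {t : ℝ} :
    Continuous fun P : ℝ × ℝ × ℝ => fiberQ p P.1 P.2.1 P.2.2 t := by
  unfold fiberQ
  fun_prop

/-- The strict signs at `t₀ - δ` and `t₀ + δ` are stable under perturbation of the coefficients, so
the intermediate value theorem gives a nearby root. No implicit function theorem is involved, and no
regularity of the root in the coefficients is claimed. -/
theorem eventually_exists_fiberQ_eq_zero {p A B C t₀ ε : ℝ} (hp : 10 / 3 < p)
    (hB : 0 ≤ B) (hC : 0 < C) (ht₀ : 0 < t₀) (hε : 0 < ε)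
    (hq : fiberQ p A B C t₀ = 0) :
    ∀ᶠ P : ℝ × ℝ × ℝ in 𝓝 (A, B, C),
      ∃ t, 0 < t ∧ |t - t₀| < ε ∧ fiberQ p P.1 P.2.1 P.2.2 t = 0 := by
  obtain ⟨δ, hδ, hδε, hδt⟩ : ∃ δ, 0 < δ ∧ δ < ε ∧ δ < t₀ := by
    obtain ⟨δ, h1, h2⟩ := exists_between (lt_min hε ht₀)
    exact ⟨δ, h1, h2.trans_le (min_le_left _ _), h2.trans_le (min_le_right _ _)⟩
  have h1 := fiberQ_pos_of_lt hp hB hC (t := t₀ - δ) (by linarith) (by linarith) hq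
  have h2 := fiberQ_neg_of_gt hp hB hC (t := t₀ + δ) ht₀ (by linarith) hq
  filter_upwards [(continuous_fiberQ (p := p) (t := t₀ - δ)).tendsto
      (A, B, C) |>.eventually_const_lt h1,
    (continuous_fiberQ (p := p) (t := t₀ + δ)).tendsto
      (A, B, C) |>.eventually_lt_const h2] with P hP1 hP2
  have hc : ContinuousOn (fun t => fiberQ p P.1 P.2.1 P.2.2 t) (Set.Icc (t₀ - δ) (t₀ + δ)) := by
    unfold fiberQ
    have : ContinuousOn (fun t : ℝ => t ^ (3 * (p - 2) / 2)) (Set.Icc (t₀ - δ) (t₀ + δ)) :=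
      continuousOn_id.rpow_const fun x hx => Or.inl (by simp only [id]; linarith [hx.1])
    fun_prop
  obtain ⟨t, ht, h0⟩ := intermediate_value_Icc' (by linarith) hc (Set.mem_Icc.2 ⟨hP2.le, hP1.le⟩)
  exact ⟨t, by linarith [ht.1], (abs_le.2 ⟨by linarith [ht.1], by linarith [ht.2]⟩).trans_lt hδε,
    h0⟩

/-- If the energy decreases to first order along a curve, it also does so after the curve is
projected on `{Q = 0}` by dilations. -/
theorem eventually_exists_fiberF_lt {p : ℝ} (hp : 10 / 3 < p) {a b k : ℝ → ℝ} {a' b' k' : ℝ}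
    (ha : HasDerivAt a a' 0) (hb : HasDerivAt b b' 0) (hk : HasDerivAt k k' 0)
    (hA : 0 ≤ a 0) (hB : 0 ≤ b 0) (hC : 0 < k 0) (hq : fiberQ p (a 0) (b 0) (k 0) 1 = 0)
    (hD : 1 / 2 * a' + 1 / 4 * b' - 1 / p * k' < 0) :
    ∀ᶠ s in 𝓝[>] (0 : ℝ), ∃ t, 0 < t ∧ fiberQ p (a s) (b s) (k s) t = 0 ∧
      fiberF p (a s) (b s) (k s) t < fiberF p (a 0) (b 0) (k 0) 1 := by
  have hle : 𝓝[>] (0 : ℝ) ≤ 𝓝[≠] 0 := nhdsWithin_mono _ fun x hx => ne_of_gt hx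
  have hcont : ContinuousAt (fun P : (ℝ × ℝ × ℝ) × ℝ => fiberF p P.1.1 P.1.2.1 P.1.2.2 P.2)
      ((a', b', k'), 1) := by
    unfold fiberF
    have : ContinuousAt (fun P : (ℝ × ℝ × ℝ) × ℝ => P.2 ^ (3 * (p - 2) / 2)) ((a', b', k'), 1) :=
      continuousAt_snd.rpow_const (Or.inl one_ne_zero)
    fun_prop
  have h0 : fiberF p a' b' k' 1 < 0 := by
    simpa only [fiberF, Real.one_rpow, one_pow, one_mul] using hD
  have hev := hcont.eventually_lt_const h0
  rw [nhds_prod_eq, eventually_prod_iff] at hev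
  obtain ⟨pa, hpa, pb, hpb, hab⟩ := hev
  obtain ⟨ε, hε, hball⟩ := Metric.eventually_nhds_iff.1 hpb
  have hslope : Tendsto (fun s => (slope a 0 s, slope b 0 s, slope k 0 s)) (𝓝[≠] 0)
      (𝓝 (a', b', k')) :=
    (hasDerivAt_iff_tendsto_slope.1 ha).prodMk_nhds
      ((hasDerivAt_iff_tendsto_slope.1 hb).prodMk_nhds (hasDerivAt_iff_tendsto_slope.1 hk))
  have hval : Tendsto (fun s => (a s, b s, k s)) (𝓝[≠] 0) (𝓝 (a 0, b 0, k 0)) :=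
    (ha.continuousAt.tendsto.prodMk_nhds (hb.continuousAt.tendsto.prodMk_nhds
      hk.continuousAt.tendsto)).mono_left nhdsWithin_le_nhds
  have hroot := eventually_exists_fiberQ_eq_zero hp hB hC one_pos hε hq
  filter_upwards [(hslope.mono_left hle).eventually hpa, (hval.mono_left hle).eventually hroot,
    self_mem_nhdsWithin] with s hs1 ⟨t, ht0, ht1, hqt⟩ hs
  refine ⟨t, ht0, hqt, ?_⟩
  have hs : 0 < s := hs
  have h1 := hab hs1 (hball (by rwa [Real.dist_eq]))
  -- Comparison with the base point dilated by the same `t`, which costs nothing because `1` is the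
  -- maximum of its fiber. As `fiberF` is linear in the three coefficients, the remaining difference
  -- is `s` times its value at the difference quotients.
  have h2 := fiberF_le_of_fiberQ_eq_zero hp hA hB ht0 hq
  have h3 : fiberF p (a s) (b s) (k s) t - fiberF p (a 0) (b 0) (k 0) t
      = s * fiberF p (slope a 0 s) (slope b 0 s) (slope k 0 s) t := by
    simp only [fiberF, slope_def_field, sub_zero]
    field_simp
    ring
  have h4 := mul_neg_of_pos_of_neg hs h1
  linarith

/-! ### Mollification and the Sobolev inequality -/

/-- Young's inequality in `L²` for convolution with a probability density. -/
theorem eLpNorm_convolution_le {ψ : E3 → ℝ} (hψ : Continuous ψ) (hψ0 : ∀ x, 0 ≤ ψ x)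
    (hψi : Integrable ψ) (hψ1 : ∫ x, ψ x = 1) {f : E3 → ℂ} (hf : StronglyMeasurable f) :
    eLpNorm (ψ ⋆[ContinuousLinearMap.lsmul ℝ ℝ, volume] f) 2 volume ≤ eLpNorm f 2 volume := by
  set d : E3 → ℝ≥0∞ := fun y => ENNReal.ofReal (ψ y) with hd
  have hdm : Measurable d := by fun_prop
  have hfm : Measurable f := hf.measurable
  set ν : Measure E3 := volume.withDensity d with hν
  have : IsProbabilityMeasure ν := ⟨by
    rw [hν, withDensity_apply _ MeasurableSet.univ, Measure.restrict_univ, hd,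
      ← ofReal_integral_eq_lintegral_ofReal hψi (Eventually.of_forall hψ0), hψ1,
      ENNReal.ofReal_one]⟩
  have key : ∀ x, ‖(ψ ⋆[ContinuousLinearMap.lsmul ℝ ℝ, volume] f) x‖ₑ ^ (2 : ℝ)
      ≤ ∫⁻ y, d y * ‖f (x - y)‖ₑ ^ (2 : ℝ) := by
    intro x
    have hm : Measurable fun y => f (x - y) := by fun_prop
    have h1 : ‖(ψ ⋆[ContinuousLinearMap.lsmul ℝ ℝ, volume] f) x‖ₑ
        ≤ ∫⁻ y, ‖f (x - y)‖ₑ ∂ν := by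
      rw [hν, lintegral_withDensity_eq_lintegral_mul _ hdm hm.enorm]
      refine (enorm_integral_le_lintegral_enorm _).trans_eq (lintegral_congr fun y => ?_)
      rw [ContinuousLinearMap.lsmul_apply, enorm_smul, Real.enorm_eq_ofReal (hψ0 y)]
      rfl
    -- Jensen's inequality for the probability measure `ν`.
    have h2 := eLpNorm_le_eLpNorm_of_exponent_le (μ := ν) (p := 1) (q := 2) (by norm_num)
      (f := fun y => f (x - y)) hm.aestronglyMeasurable
    rw [eLpNorm_one_eq_lintegral_enorm] at h2
    refine (ENNReal.rpow_le_rpow (h1.trans h2) (by norm_num)).trans_eq ?_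
    rw [eLpNorm_eq_lintegral_rpow_enorm_toReal (by norm_num) (by norm_num), ← ENNReal.rpow_mul,
      hν, lintegral_withDensity_eq_lintegral_mul _ hdm (by fun_prop)]
    simp
  have h3 : ∫⁻ x, ∫⁻ y, d y * ‖f (x - y)‖ₑ ^ (2 : ℝ) = ∫⁻ x, ‖f x‖ₑ ^ (2 : ℝ) := by
    rw [lintegral_lintegral_swap (by fun_prop)]
    have : ∀ y, ∫⁻ x, d y * ‖f (x - y)‖ₑ ^ (2 : ℝ) = d y * ∫⁻ x, ‖f x‖ₑ ^ (2 : ℝ) := by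
      intro y
      rw [lintegral_const_mul _ (by fun_prop)]
      congr 1
      exact lintegral_sub_right_eq_self (fun x => ‖f x‖ₑ ^ (2 : ℝ)) y
    simp_rw [this]
    rw [lintegral_mul_const _ hdm, hd,
      ← ofReal_integral_eq_lintegral_ofReal hψi (Eventually.of_forall hψ0), hψ1,
      ENNReal.ofReal_one, one_mul]
  rw [eLpNorm_eq_lintegral_rpow_enorm_toReal (by norm_num) (by norm_num),
    eLpNorm_eq_lintegral_rpow_enorm_toReal (by norm_num) (by norm_num)]
  simp only [ENNReal.toReal_ofNat]
  exact ENNReal.rpow_le_rpow ((lintegral_mono key).trans_eq h3) (by norm_num)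

theorem locallyIntegrable_fst (u : H1) : LocallyIntegrable (fn u) volume :=
  (Lp.memLp u.1.fst).locallyIntegrable (by norm_num)

/-- The derivative of a mollification of `u` is the mollification of the weak gradient. -/
theorem fderiv_convolution_single {ψ : E3 → ℝ} (hψ : ContDiff ℝ ∞ ψ) (hc : HasCompactSupport ψ)
    (u : H1) (x : E3) (i : Fin 3) :
    fderiv ℝ (ψ ⋆[ContinuousLinearMap.lsmul ℝ ℝ, volume] fn u) x (EuclideanSpace.single i 1)
      = (ψ ⋆[ContinuousLinearMap.lsmul ℝ ℝ, volume] fun y => grad u y i) x := by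
  rw [(hc.hasFDerivAt_convolution_left (ContinuousLinearMap.lsmul ℝ ℝ) (hψ.of_le (by simp))
    (locallyIntegrable_fst u) x).fderiv]
  have hex : ConvolutionExistsAt (fderiv ℝ ψ) (fn u) x
      ((ContinuousLinearMap.lsmul ℝ ℝ : ℝ →L[ℝ] ℂ →L[ℝ] ℂ).precompL E3) volume :=
    (hc.fderiv ℝ).convolutionExists_left _ (hψ.continuous_fderiv (by simp))
      (locallyIntegrable_fst u) x
  rw [convolution_def, ContinuousLinearMap.integral_apply hex]
  simp only [ContinuousLinearMap.precompL_apply, ContinuousLinearMap.lsmul_apply]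
  rw [← integral_sub_left_eq_self _ volume x]
  simp only [sub_sub_cancel]
  -- The weak gradient is tested with `y ↦ ψ (x - y)`; the sign from the chain rule cancels the one
  -- from integration by parts.
  have hφ : ContDiff ℝ ∞ fun y => ψ (x - y) := hψ.comp (contDiff_const.sub contDiff_id)
  have hφc : HasCompactSupport fun y => ψ (x - y) := by
    have := hc.comp_homeomorph (Homeomorph.subLeft x)
    exact this
  have hder : ∀ y, fderiv ℝ (fun y => ψ (x - y)) y (EuclideanSpace.single i 1)
      = - fderiv ℝ ψ (x - y) (EuclideanSpace.single i 1) := by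
    intro y
    have h : HasFDerivAt (fun y => ψ (x - y)) ((fderiv ℝ ψ (x - y)).comp
        (-ContinuousLinearMap.id ℝ E3)) y :=
      ((hψ.differentiable (by simp) (x - y)).hasFDerivAt).comp y
        ((hasFDerivAt_id y).const_sub x)
    rw [h.fderiv]
    simp
  have h := u.2 _ hφ hφc i
  simp only [hder, neg_smul] at h
  rw [integral_neg, neg_inj] at h
  refine h.trans ?_
  rw [convolution_def, ← integral_sub_left_eq_self _ volume x]
  simp [grad]

theorem norm_le_sum_single (L : E3 →L[ℝ] ℂ) :
    ‖L‖ ≤ ∑ i, ‖L (EuclideanSpace.single i 1)‖ := by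
  refine L.opNorm_le_bound (Finset.sum_nonneg fun _ _ => norm_nonneg _) fun v => ?_
  have : v = ∑ i, v i • (EuclideanSpace.single i (1 : ℝ) : E3) := by
    ext j
    simp [Finset.sum_apply, Pi.single_apply]
  conv_lhs => rw [this, map_sum]
  refine (norm_sum_le _ _).trans ?_
  rw [Finset.sum_mul]
  refine Finset.sum_le_sum fun i _ => ?_
  rw [map_smul, norm_smul, mul_comm]
  exact mul_le_mul_of_nonneg_left (PiLp.norm_apply_le v i) (norm_nonneg _)

theorem exists_cutoff : ∃ χ : E3 → ℝ, ContDiff ℝ ∞ χ ∧ HasCompactSupport χ ∧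
    (∀ x, ‖χ x‖ ≤ 1) ∧ (∀ x, ‖x‖ ≤ 1 → χ x = 1) ∧ ∃ M : ℝ≥0, ∀ x, ‖fderiv ℝ χ x‖ ≤ M := by
  let φ : ContDiffBump (0 : E3) := ⟨1, 2, one_pos, one_lt_two⟩
  refine ⟨φ, φ.contDiff, φ.hasCompactSupport, fun x => ?_, fun x hx => ?_, ?_⟩
  · rw [Real.norm_of_nonneg φ.nonneg]
    exact φ.le_one
  · exact φ.one_of_mem_closedBall (by simpa using hx)
  · obtain ⟨M, hM⟩ := (φ.hasCompactSupport.fderiv ℝ).exists_bound_of_continuous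
      (φ.contDiff (n := 1).continuous_fderiv (by simp))
    exact ⟨M.toNNReal, fun x => (hM x).trans (Real.le_coe_toNNReal M)⟩

theorem eLpNorm_grad_apply_le (u : H1) (i : Fin 3) :
    eLpNorm (fun x => grad u x i) 2 volume ≤ eLpNorm (grad u) 2 volume :=
  eLpNorm_mono fun _ => PiLp.norm_apply_le _ i

/-- A version of the Sobolev inequality on `ℝ³`. -/
theorem exists_eLpNorm_six_le : ∃ K : ℝ≥0, ∀ u : H1,
    eLpNorm (fn u) 6 volume ≤ K * (eLpNorm (fn u) 2 volume + eLpNorm (grad u) 2 volume) := by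
  obtain ⟨χ, hχ, hχc, hχ1, hχone, M, hM⟩ := exists_cutoff
  set S₀ : ℝ≥0 := SNormLESNormFDerivOfEqConst ℂ (volume : Measure E3) (2 : ℝ≥0)
  -- `M` bounds the gradient of the cutoff, and `3` comes from bounding the derivative by the sum of
  -- three partial derivatives.
  refine ⟨S₀ * (M + 3), fun u => ?_⟩
  -- The fixed ratio 2 of outer to inner radius is what the almost everywhere convergence of the
  -- mollifications requires.
  let φ : ℕ → ContDiffBump (0 : E3) := fun n =>
    ⟨1 / (n + 1), 2 / (n + 1), by positivity, by gcongr; norm_num⟩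
  have hrout : Tendsto (fun n => (φ n).rOut) atTop (𝓝 0) := by
    have := (tendsto_one_div_add_atTop_nhds_zero_nat (𝕜 := ℝ)).const_mul 2
    simpa only [φ, mul_one_div, mul_zero] using this
  have hψs : ∀ n, ContDiff ℝ ∞ ((φ n).normed volume) := fun n => (φ n).contDiff_normed
  have hψc : ∀ n, HasCompactSupport ((φ n).normed volume) := fun n => (φ n).hasCompactSupport_normed
  set m : ℕ → E3 → ℂ := fun n =>
    (φ n).normed volume ⋆[ContinuousLinearMap.lsmul ℝ ℝ, volume] fn u with hm
  have hm1 : ∀ n, ContDiff ℝ 1 (m n) := fun n =>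
    (hψc n).contDiff_convolution_left _ ((hψs n).of_le (by simp)) (locallyIntegrable_fst u)
  have hm2 : ∀ n, eLpNorm (m n) 2 volume ≤ eLpNorm (fn u) 2 volume := fun n =>
    eLpNorm_convolution_le (hψs n).continuous (φ n).nonneg_normed (φ n).integrable_normed
      (φ n).integral_normed (Lp.stronglyMeasurable u.1.fst)
  have hmd : ∀ n, eLpNorm (fderiv ℝ (m n)) 2 volume ≤ 3 * eLpNorm (grad u) 2 volume := by
    intro n
    set G : Fin 3 → E3 → ℂ := fun i =>
      (φ n).normed volume ⋆[ContinuousLinearMap.lsmul ℝ ℝ, volume] fun y => grad u y i with hG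
    have hGe : ∀ i, G i = fun x => fderiv ℝ (m n) x (EuclideanSpace.single i 1) := fun i =>
      funext fun x => (fderiv_convolution_single (hψs n) (hψc n) u x i).symm
    have hGc : ∀ i, Continuous (G i) := fun i => by
      rw [hGe i]
      exact ((hm1 n).continuous_fderiv (by simp)).clm_apply continuous_const
    have h1 : eLpNorm (fderiv ℝ (m n)) 2 volume ≤ eLpNorm (∑ i, fun x => ‖G i x‖) 2 volume := by
      refine eLpNorm_mono_real fun x => ?_
      rw [Finset.sum_apply]
      simp only [hGe]
      exact norm_le_sum_single _
    refine h1.trans ((eLpNorm_sum_le (fun i _ => (hGc i).norm.aestronglyMeasurable)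
      (by norm_num)).trans ?_)
    have h2 : ∀ i ∈ Finset.univ, eLpNorm (fun x => ‖G i x‖) 2 volume
        ≤ eLpNorm (grad u) 2 volume := by
      intro i _
      rw [eLpNorm_norm]
      refine (eLpNorm_convolution_le (hψs n).continuous (φ n).nonneg_normed (φ n).integrable_normed
        (φ n).integral_normed ?_).trans (eLpNorm_grad_apply_le u i)
      exact (EuclideanSpace.proj (𝕜 := ℂ) i :
        EuclideanSpace ℂ (Fin 3) →L[ℂ] ℂ).continuous.comp_stronglyMeasurable
          (Lp.stronglyMeasurable u.1.snd)
    refine (Finset.sum_le_card_nsmul _ _ _ h2).trans_eq ?_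
    simp
  -- Dilated cutoffs make the mollifications compactly supported, with gradients bounded by `M`
  -- uniformly in `n`; the inequality for compactly supported `C¹` functions then applies.
  set w : ℕ → E3 → ℂ := fun n x => χ ((1 / (n + 1 : ℝ)) • x) • m n x with hw
  have hχn : ∀ n : ℕ, ContDiff ℝ 1 fun x : E3 => χ ((1 / (n + 1 : ℝ)) • x) := fun n =>
    (hχ.of_le (by simp)).comp (contDiff_const_smul _)
  have hw1 : ∀ n, ContDiff ℝ 1 (w n) := fun n => (hχn n).smul (hm1 n)
  have hwc : ∀ n, HasCompactSupport (w n) := fun n => by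
    have h : HasCompactSupport fun x : E3 => χ ((1 / (n + 1 : ℝ)) • x) :=
      hχc.comp_homeomorph (Homeomorph.smulOfNeZero (1 / (n + 1 : ℝ)) (by positivity))
    exact h.smul_right
  have hwd : ∀ n x, ‖fderiv ℝ (w n) x‖ ≤ ‖fderiv ℝ (m n) x‖ + M * ‖m n x‖ := by
    intro n x
    have h1 := (((hχn n).differentiable (by simp) x).hasFDerivAt.smul
      ((hm1 n).differentiable (by simp) x).hasFDerivAt).fderiv
    have h2 : ‖fderiv ℝ (fun x : E3 => χ ((1 / (n + 1 : ℝ)) • x)) x‖ ≤ M := by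
      rw [fderiv_comp_smul, norm_smul]
      have h3 : ‖(1 / (n + 1 : ℝ))‖ ≤ 1 := by
        rw [Real.norm_of_nonneg (by positivity), div_le_one (by positivity)]
        linarith [(Nat.cast_nonneg n : (0 : ℝ) ≤ n)]
      nlinarith [hM ((1 / (n + 1 : ℝ)) • x), norm_nonneg (fderiv ℝ χ ((1 / (n + 1 : ℝ)) • x))]
    change ‖fderiv ℝ ((fun x : E3 => χ ((1 / (n + 1 : ℝ)) • x)) • m n) x‖ ≤ _
    rw [h1]
    refine (norm_add_le _ _).trans (add_le_add ?_ ?_)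
    · rw [norm_smul]
      nlinarith [hχ1 ((1 / (n + 1 : ℝ)) • x), norm_nonneg (fderiv ℝ (m n) x)]
    · rw [ContinuousLinearMap.norm_smulRight_apply]
      exact mul_le_mul_of_nonneg_right h2 (norm_nonneg _)
  have hbound : ∀ n, eLpNorm (w n) 6 volume
      ≤ ↑(S₀ * (M + 3)) * (eLpNorm (fn u) 2 volume + eLpNorm (grad u) 2 volume) := by
    intro n
    have h1 := eLpNorm_le_eLpNorm_fderiv_of_eq (volume : Measure E3) (hw1 n) (hwc n)
      (p := 2) (p' := 6) (by norm_num) (by simp) (by simp; norm_num)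
    have h2 : eLpNorm (fderiv ℝ (w n)) 2 volume
        ≤ eLpNorm (fderiv ℝ (m n)) 2 volume + M * eLpNorm (m n) 2 volume := by
      have h3 := eLpNorm_mono_real (μ := volume) (p := 2) (hwd n)
      refine h3.trans ((eLpNorm_add_le (f := fun x => ‖fderiv ℝ (m n) x‖)
        (g := fun x => (M : ℝ) * ‖m n x‖)
        ((hm1 n).continuous_fderiv (by simp)).norm.aestronglyMeasurable
        ((hm1 n).continuous.norm.const_mul _).aestronglyMeasurable (by norm_num)).trans_eq ?_)
      rw [eLpNorm_norm]
      congr 1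
      have := eLpNorm_const_smul (M : ℝ) (fun x => ‖m n x‖) 2 (volume : Measure E3)
      rw [eLpNorm_norm] at this
      refine Eq.trans ?_ (this.trans ?_)
      · rfl
      · congr 1
        simp
    refine h1.trans ?_
    push_cast
    rw [mul_assoc]
    refine mul_le_mul_right ?_ _
    refine h2.trans ((add_le_add (hmd n) (mul_le_mul_right (hm2 n) _)).trans ?_)
    rw [add_mul, mul_add, mul_add, add_comm]
    refine add_le_add le_self_add le_add_self
  have hlim : ∀ᵐ x, Tendsto (fun n => w n x) atTop (𝓝 (fn u x)) := by
    have := ContDiffBump.ae_convolution_tendsto_right_of_locallyIntegrable (μ := volume)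
      (φ := φ) (l := atTop) (K := 2) hrout (Eventually.of_forall fun n => by
        simp only [φ]; rw [mul_one_div]) (locallyIntegrable_fst u)
    filter_upwards [this] with x hx
    refine hx.congr' ?_
    filter_upwards [eventually_ge_atTop ⌈‖x‖⌉₊] with n hn
    have h1 : ‖(1 / (n + 1 : ℝ)) • x‖ ≤ 1 := by
      rw [norm_smul, Real.norm_of_nonneg (by positivity), one_div, inv_mul_le_one₀ (by positivity)]
      linarith [Nat.ceil_le.1 hn]
    simp only [hw, hχone _ h1, one_smul, hm]
  -- Fatou's lemma transfers the uniform bound to the limit.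
  refine (Lp.eLpNorm_lim_le_liminf_eLpNorm
    (fun n => (hw1 n).continuous.aestronglyMeasurable) _ hlim).trans ?_
  exact liminf_le_of_le (by isBoundedDefault) fun b hb => by
    obtain ⟨n, hn⟩ := hb.exists
    exact hn.trans (hbound n)

/-! ### Norms and integrability in `H¹` -/

theorem norm_sq_eq (u : H1) : ‖u‖ ^ 2 = ‖u.1.fst‖ ^ 2 + ‖u.1.snd‖ ^ 2 := by
  rw [Submodule.coe_norm, WithLp.prod_norm_sq_eq_of_L2]

theorem norm_fst_le (u : H1) : ‖u.1.fst‖ ≤ ‖u‖ :=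
  le_of_abs_le (abs_le_of_sq_le_sq (by
    rw [norm_sq_eq]; nlinarith [sq_nonneg ‖u.1.fst‖, sq_nonneg ‖u.1.snd‖]) (norm_nonneg _))

theorem norm_snd_le (u : H1) : ‖u.1.snd‖ ≤ ‖u‖ :=
  le_of_abs_le (abs_le_of_sq_le_sq (by
    rw [norm_sq_eq]; nlinarith [sq_nonneg ‖u.1.fst‖, sq_nonneg ‖u.1.snd‖]) (norm_nonneg _))

theorem fn_add (u v : H1) : fn (u + v) =ᵐ[volume] fun x => fn u x + fn v x :=
  Lp.coeFn_add u.1.fst v.1.fst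

theorem fn_smul (z : ℂ) (u : H1) : fn (z • u) =ᵐ[volume] fun x => z * fn u x :=
  Lp.coeFn_smul z u.1.fst

theorem fn_real_smul (t : ℝ) (u : H1) : fn (t • u) =ᵐ[volume] fun x => t * fn u x := by
  filter_upwards [Lp.coeFn_smul t u.1.fst] with x hx
  exact hx.trans (Complex.real_smul ..)

theorem fn_zero : fn 0 =ᵐ[volume] fun _ => 0 := Lp.coeFn_zero ..

theorem stronglyMeasurable_fn (u : H1) : StronglyMeasurable (fn u) :=
  Lp.stronglyMeasurable u.1.fst

@[fun_prop]
theorem measurable_fn (u : H1) : Measurable (fn u) := (stronglyMeasurable_fn u).measurable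

theorem memLp_two (u : H1) : MemLp (fn u) 2 volume := Lp.memLp u.1.fst

theorem integrable_norm_sq (u : H1) : Integrable fun x => ‖fn u x‖ ^ 2 :=
  (memLp_two u).integrable_norm_pow (by norm_num)

theorem Lp_norm_sq {E : Type*} [NormedAddCommGroup E] [InnerProductSpace ℂ E]
    (f : Lp E 2 (volume : Measure E3)) : ‖f‖ ^ 2 = ∫ x, ‖f x‖ ^ 2 := by
  rw [← inner_self_eq_norm_sq (𝕜 := ℂ), L2.inner_def]
  simp only [inner_self_eq_norm_sq_to_K]
  norm_cast

theorem mass_eq (u : H1) : mass u = ‖u.1.fst‖ ^ 2 := (Lp_norm_sq _).symm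

theorem kinetic_eq (u : H1) : kinetic u = ‖u.1.snd‖ ^ 2 := (Lp_norm_sq _).symm

/-- The quantitative part is stated on the unit ball only; `exists_power_le` and
`exists_potential_le` recover their bounds for all `u` by homogeneity. -/
theorem exists_sobolev_bound : ∃ K : ℝ, 0 ≤ K ∧ ∀ u : H1, MemLp (fn u) 6 volume ∧
    (‖u‖ ≤ 1 → ∫ x, ‖fn u x‖ ^ 6 ≤ K) := by
  obtain ⟨K, hK⟩ := exists_eLpNorm_six_le
  have h1 : ∀ u : H1, eLpNorm (fn u) 2 volume = ENNReal.ofReal ‖u.1.fst‖ := fun u => by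
    rw [Lp.norm_def, ENNReal.ofReal_toReal (Lp.eLpNorm_ne_top _)]; rfl
  have h2 : ∀ u : H1, eLpNorm (grad u) 2 volume = ENNReal.ofReal ‖u.1.snd‖ := fun u => by
    rw [Lp.norm_def, ENNReal.ofReal_toReal (Lp.eLpNorm_ne_top _)]; rfl
  have h3 : ∀ u : H1, MemLp (fn u) 6 volume := fun u => by
    refine ⟨(stronglyMeasurable_fn u).aestronglyMeasurable, (hK u).trans_lt ?_⟩
    rw [h1, h2, ← ENNReal.ofReal_add (norm_nonneg _) (norm_nonneg _)]
    exact ENNReal.mul_lt_top ENNReal.coe_lt_top ENNReal.ofReal_lt_top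
  refine ⟨(K * 2) ^ 6, by positivity, fun u => ⟨h3 u, fun hu => ?_⟩⟩
  have h4 : eLpNorm (fn u) 6 volume ≤ ENNReal.ofReal (K * 2) := by
    refine (hK u).trans ?_
    rw [h1, h2, ← ENNReal.ofReal_add (norm_nonneg _) (norm_nonneg _),
      ENNReal.ofReal_mul K.coe_nonneg, ENNReal.ofReal_coe_nnreal]
    refine mul_le_mul_right (ENNReal.ofReal_le_ofReal ?_) _
    linarith [norm_fst_le u, norm_snd_le u]
  have h5 := (h3 u).eLpNorm_eq_integral_rpow_norm (by norm_num) (by norm_num)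
  rw [h5] at h4
  have h6 := (ENNReal.ofReal_le_ofReal_iff (by positivity)).1 h4
  have h7 : 0 ≤ ∫ x, ‖fn u x‖ ^ (6 : ℝ) := integral_nonneg fun x => by positivity
  have h8 : ∫ x, ‖fn u x‖ ^ (6 : ℝ) = ∫ x, ‖fn u x‖ ^ 6 := by
    congr 1; ext x; norm_cast
  simp only [ENNReal.toReal_ofNat] at h6
  rw [← h8]
  calc ∫ x, ‖fn u x‖ ^ (6 : ℝ) = ((∫ x, ‖fn u x‖ ^ (6 : ℝ)) ^ (6 : ℝ)⁻¹) ^ 6 := by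
        rw [← Real.rpow_natCast, ← Real.rpow_mul h7]; norm_num
    _ ≤ _ := pow_le_pow_left₀ (by positivity) h6 6

theorem memLp_six (u : H1) : MemLp (fn u) 6 volume := (exists_sobolev_bound.choose_spec.2 u).1

theorem integrable_norm_pow_six (u : H1) : Integrable fun x => ‖fn u x‖ ^ 6 :=
  (memLp_six u).integrable_norm_pow (by norm_num)

theorem rpow_le_sq_add_pow_six {a p : ℝ} (ha : 0 ≤ a) (hp : 2 ≤ p) (hp6 : p ≤ 6) :
    a ^ p ≤ a ^ 2 + a ^ 6 := by
  rcases le_total a 1 with h | h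
  · have : a ^ p ≤ a ^ 2 := by
      rcases ha.eq_or_lt with rfl | h0
      · rw [Real.zero_rpow (by linarith)]; positivity
      · rw [← Real.rpow_natCast]
        exact Real.rpow_le_rpow_of_exponent_ge h0 h (by exact_mod_cast hp)
    linarith [pow_nonneg ha 6]
  · have : a ^ p ≤ a ^ 6 := by
      rw [← Real.rpow_natCast]
      exact Real.rpow_le_rpow_of_exponent_le h (by exact_mod_cast hp6)
    linarith [pow_nonneg ha 2]

theorem integrable_norm_rpow {p : ℝ} (hp : 2 ≤ p) (hp6 : p ≤ 6) (u : H1) :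
    Integrable fun x => ‖fn u x‖ ^ p := by
  refine ((integrable_norm_sq u).add (integrable_norm_pow_six u)).mono'
    ((measurable_fn u).norm.pow_const p).aestronglyMeasurable (Eventually.of_forall fun x => ?_)
  rw [Real.norm_of_nonneg (by positivity)]
  exact rpow_le_sq_add_pow_six (norm_nonneg _) hp hp6

theorem power_smul {p : ℝ} {t : ℝ} (ht : 0 ≤ t) (u : H1) :
    power p (t • u) = t ^ p * power p u := by
  rw [power, power, ← integral_const_mul]
  refine integral_congr_ae ?_
  filter_upwards [fn_real_smul t u] with x hx
  rw [hx, norm_mul, Complex.norm_real, Real.norm_of_nonneg ht, Real.mul_rpow ht (norm_nonneg _)]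

theorem exists_norm_le_one_smul (u : H1) : ∃ v : H1, ‖v‖ ≤ 1 ∧ u = ‖u‖ • v := by
  rcases eq_or_ne u 0 with rfl | h
  · exact ⟨0, by simp, by simp⟩
  · have h0 : ‖u‖ ≠ 0 := norm_ne_zero_iff.2 h
    refine ⟨‖u‖⁻¹ • u, ?_, by rw [smul_inv_smul₀ h0]⟩
    rw [norm_smul, norm_inv, norm_norm, inv_mul_cancel₀ h0]

theorem exists_power_le {p : ℝ} (hp : 2 ≤ p) (hp6 : p ≤ 6) :
    ∃ K : ℝ, 0 ≤ K ∧ ∀ u : H1, power p u ≤ K * ‖u‖ ^ p := by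
  obtain ⟨K, hK0, hK⟩ := exists_sobolev_bound
  refine ⟨1 + K, by positivity, fun u => ?_⟩
  obtain ⟨v, hv, huv⟩ := exists_norm_le_one_smul u
  have h1 : power p v ≤ 1 + K := by
    calc power p v ≤ ∫ x, ‖fn v x‖ ^ 2 + ‖fn v x‖ ^ 6 :=
          integral_mono (integrable_norm_rpow hp hp6 v)
            ((integrable_norm_sq v).add (integrable_norm_pow_six v))
            fun x => rpow_le_sq_add_pow_six (norm_nonneg _) hp hp6
      _ = mass v + ∫ x, ‖fn v x‖ ^ 6 :=
          integral_add (integrable_norm_sq v) (integrable_norm_pow_six v)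
      _ ≤ 1 + K := by
          refine add_le_add ?_ ((hK v).2 hv)
          rw [mass_eq]
          nlinarith [norm_fst_le v, norm_nonneg v.1.fst]
  have h2 : power p u = ‖u‖ ^ p * power p v := by
    conv_lhs => rw [huv]
    exact power_smul (norm_nonneg _) v
  rw [h2, mul_comm]
  exact mul_le_mul_of_nonneg_right h1 (by positivity)

/-! ### Uniform bound for the Newtonian potential -/

/-- A truncation of `‖y‖^{-3/2}` to the unit ball. -/
noncomputable def nearKernel (y : E3) : ℝ :=
  (Metric.ball 0 1).indicator (fun y => ‖y‖ ^ (-(3 / 2) : ℝ)) y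

theorem nearKernel_nonneg (y : E3) : 0 ≤ nearKernel y :=
  Set.indicator_nonneg (fun _ _ => by positivity) _

theorem integrable_nearKernel : Integrable nearKernel := by
  refine (integrable_indicator_iff Metric.isOpen_ball.measurableSet).2 ?_
  refine integrableOn_ball_of_norm_le_rpow (C := 1) (α := 3 / 2) (by simp) (by norm_num)
    (Eventually.of_forall fun x => ?_) (measurable_norm.pow_const _).aestronglyMeasurable
  rw [Real.norm_of_nonneg (by positivity), one_mul]

/-- For `‖y‖ < 1` either `a² ≤ ‖y‖^{-1/2}`, and the quotient is at most `‖y‖^{-3/2}`, which is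
integrable near the origin, or `‖y‖⁻¹ ≤ a⁴`, and it is at most `a⁶`. Thus the `L²` and `L⁶` bounds
alone control the potential uniformly in `x`. -/
theorem sq_div_le_nearKernel (a : ℝ) (y : E3) :
    a ^ 2 / ‖y‖ ≤ a ^ 2 + a ^ 6 + nearKernel y := by
  rcases eq_or_ne y 0 with rfl | hy
  · have := nearKernel_nonneg 0
    simp only [norm_zero, div_zero]
    positivity
  have hr : 0 < ‖y‖ := norm_pos_iff.2 hy
  rcases le_or_gt 1 ‖y‖ with h | h
  · have := div_le_self (sq_nonneg a) h
    have := nearKernel_nonneg y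
    have : 0 ≤ a ^ 6 := by positivity
    linarith
  · rw [nearKernel, Set.indicator_of_mem (by simpa using h)]
    have e : ‖y‖ ^ (-(3 / 2) : ℝ) = ‖y‖ ^ (-(1 / 2) : ℝ) / ‖y‖ := by
      rw [← Real.rpow_sub_one hr.ne']; norm_num
    have h2 : 0 ≤ a ^ 2 := sq_nonneg a
    have h6 : 0 ≤ a ^ 6 := by positivity
    rcases le_total (a ^ 2) (‖y‖ ^ (-(1 / 2) : ℝ)) with h' | h'
    · rw [e]
      have := div_le_div_of_nonneg_right h' hr.le
      linarith
    · have h3 : ‖y‖⁻¹ ≤ a ^ 4 := by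
        calc ‖y‖⁻¹ = (‖y‖ ^ (-(1 / 2) : ℝ)) ^ 2 := by
              rw [← Real.rpow_natCast, ← Real.rpow_mul hr.le, ← Real.rpow_neg_one]; norm_num
          _ ≤ (a ^ 2) ^ 2 := pow_le_pow_left₀ (by positivity) h' 2
          _ = a ^ 4 := by ring
      have h4 : a ^ 2 / ‖y‖ ≤ a ^ 6 := by
        rw [div_eq_mul_inv]
        nlinarith
      have : 0 ≤ ‖y‖ ^ (-(3 / 2) : ℝ) := by positivity
      linarith

theorem integrable_potential (u : H1) (x : E3) : Integrable fun y => ‖fn u y‖ ^ 2 / ‖x - y‖ := by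
  refine (((integrable_norm_sq u).add (integrable_norm_pow_six u)).add
    (integrable_nearKernel.comp_sub_left x)).mono'
    (by exact Measurable.aestronglyMeasurable (by fun_prop)) (Eventually.of_forall fun y => ?_)
  rw [Real.norm_of_nonneg (by positivity)]
  exact sq_div_le_nearKernel _ (x - y)

theorem potential_nonneg (u : H1) (x : E3) : 0 ≤ potential u x :=
  integral_nonneg fun y => by positivity

theorem potential_smul (t : ℝ) (u : H1) (x : E3) :
    potential (t • u) x = t ^ 2 * potential u x := by
  rw [potential, potential, ← integral_const_mul]
  refine integral_congr_ae ?_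
  filter_upwards [fn_real_smul t u] with y hy
  rw [hy, norm_mul, Complex.norm_real, mul_pow, Real.norm_eq_abs, sq_abs, mul_div_assoc]

theorem exists_potential_le : ∃ K : ℝ, 0 ≤ K ∧
    ∀ (u : H1) (x : E3), potential u x ≤ K * ‖u‖ ^ 2 := by
  obtain ⟨K, hK0, hK⟩ := exists_sobolev_bound
  have hI : 0 ≤ ∫ y, nearKernel y := integral_nonneg nearKernel_nonneg
  refine ⟨1 + K + ∫ y, nearKernel y, by positivity, fun u x => ?_⟩
  obtain ⟨v, hv, huv⟩ := exists_norm_le_one_smul u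
  have h1 : potential v x ≤ 1 + K + ∫ y, nearKernel y := by
    have i1 : Integrable fun y => ‖fn v y‖ ^ 2 + ‖fn v y‖ ^ 6 :=
      (integrable_norm_sq v).add (integrable_norm_pow_six v)
    calc potential v x ≤ ∫ y, ‖fn v y‖ ^ 2 + ‖fn v y‖ ^ 6 + nearKernel (x - y) :=
          integral_mono (integrable_potential v x) (i1.add (integrable_nearKernel.comp_sub_left x))
            fun y => sq_div_le_nearKernel _ (x - y)
      _ = mass v + (∫ x, ‖fn v x‖ ^ 6) + ∫ y, nearKernel y := by
          rw [integral_add i1 (integrable_nearKernel.comp_sub_left x),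
            integral_add (integrable_norm_sq v) (integrable_norm_pow_six v),
            integral_sub_left_eq_self nearKernel volume x]
          rfl
      _ ≤ _ := by
          gcongr
          · rw [mass_eq]
            nlinarith [norm_fst_le v, norm_nonneg v.1.fst]
          · exact (hK v).2 hv
  rw [huv, potential_smul, ← huv, mul_comm]
  exact mul_le_mul_of_nonneg_right h1 (by positivity)

/-! ### The Coulomb energy as a bilinear form -/

/-- Integrable functions on `ℝ³` whose Newtonian potential converges absolutely and is bounded. -/
def boundedPotential : Submodule ℝ (E3 → ℝ) where
  carrier := {f | Integrable f ∧ (∀ x, Integrable fun y => f y / ‖x - y‖) ∧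
    ∃ K, ∀ x, ∫ y, |f y| / ‖x - y‖ ≤ K}
  zero_mem' := ⟨integrable_zero _ _ _, fun x => by simp, 0, fun x => by simp⟩
  add_mem' := by
    rintro f g ⟨hf, hf', K, hK⟩ ⟨hg, hg', L, hL⟩
    refine ⟨hf.add hg, fun x => ?_, K + L, fun x => ?_⟩
    · simp only [Pi.add_apply, add_div]
      exact (hf' x).add (hg' x)
    · have h1 : Integrable fun y => |f y| / ‖x - y‖ := by
        simpa only [norm_div, Real.norm_eq_abs, abs_norm] using (hf' x).norm
      have h2 : Integrable fun y => |g y| / ‖x - y‖ := by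
        simpa only [norm_div, Real.norm_eq_abs, abs_norm] using (hg' x).norm
      refine le_trans ?_ (add_le_add (hK x) (hL x))
      rw [← integral_add h1 h2]
      refine integral_mono_of_nonneg (Eventually.of_forall fun y => by positivity) (h1.add h2)
        (Eventually.of_forall fun y => ?_)
      simp only [Pi.add_apply, ← add_div]
      gcongr
      exact abs_add_le _ _
  smul_mem' := by
    rintro t f ⟨hf, hf', K, hK⟩
    refine ⟨hf.smul t, fun x => ?_, |t| * K, fun x => ?_⟩
    · simpa only [Pi.smul_apply, smul_eq_mul, mul_div_assoc] using (hf' x).const_mul t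
    · simp only [Pi.smul_apply, smul_eq_mul, abs_mul, mul_div_assoc]
      rw [integral_const_mul]
      exact mul_le_mul_of_nonneg_left (hK x) (abs_nonneg t)

/-- Integrating first in the second variable leaves at most `K |f|`. This gives the Fubini theorem
behind the bilinearity and symmetry of `interaction`. -/
theorem integrable_coulomb {f g : E3 → ℝ} (hf : f ∈ boundedPotential) (hg : g ∈ boundedPotential) :
    Integrable (fun z : E3 × E3 => f z.1 * (g z.2 / ‖z.1 - z.2‖)) (volume.prod volume) := by
  obtain ⟨hg, hg', K, hK⟩ := hg
  have hm : AEStronglyMeasurable (fun z : E3 × E3 => f z.1 * (g z.2 / ‖z.1 - z.2‖))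
      (volume.prod volume) := by
    refine hf.1.1.comp_fst.mul ?_
    exact (hg.1.comp_snd.aemeasurable.div (by fun_prop)).aestronglyMeasurable
  refine (integrable_prod_iff hm).2 ⟨Eventually.of_forall fun x => by
    exact (hg' x).const_mul (f x), ?_⟩
  refine (hf.1.norm.mul_const K).mono' hm.norm.integral_prod_right'
    (Eventually.of_forall fun x => ?_)
  rw [Real.norm_of_nonneg (integral_nonneg fun y => norm_nonneg _)]
  simp only [norm_mul, norm_div, norm_norm]
  rw [integral_const_mul]
  exact mul_le_mul_of_nonneg_left (hK x) (norm_nonneg _)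

/-- The Coulomb interaction energy of two densities. -/
noncomputable def interaction : boundedPotential →ₗ[ℝ] boundedPotential →ₗ[ℝ] ℝ :=
  LinearMap.mk₂ ℝ (fun f g => ∫ x, f.1 x * ∫ y, g.1 y / ‖x - y‖)
    (fun f f' g => by
      have h1 := (integrable_coulomb f.2 g.2).integral_prod_left
      have h2 := (integrable_coulomb f'.2 g.2).integral_prod_left
      simp only [integral_const_mul] at h1 h2
      rw [← integral_add h1 h2]
      exact integral_congr_ae (Eventually.of_forall fun x => by
        simp only [Submodule.coe_add, Pi.add_apply, add_mul]))
    (fun t f g => by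
      rw [smul_eq_mul, ← integral_const_mul]
      exact integral_congr_ae (Eventually.of_forall fun x => by
        simp only [Submodule.coe_smul, Pi.smul_apply, smul_eq_mul, mul_assoc]))
    (fun f g g' => by
      have h1 := (integrable_coulomb f.2 g.2).integral_prod_left
      have h2 := (integrable_coulomb f.2 g'.2).integral_prod_left
      simp only [integral_const_mul] at h1 h2
      rw [← integral_add h1 h2]
      exact integral_congr_ae (Eventually.of_forall fun x => by
        simp only [Submodule.coe_add, Pi.add_apply, add_div]
        rw [integral_add (g.2.2.1 x) (g'.2.2.1 x), mul_add]))
    (fun t f g => by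
      rw [smul_eq_mul, ← integral_const_mul]
      exact integral_congr_ae (Eventually.of_forall fun x => by
        simp only [Submodule.coe_smul, Pi.smul_apply, smul_eq_mul, mul_div_assoc]
        rw [integral_const_mul]
        ring))

theorem interaction_apply (f g : boundedPotential) :
    interaction f g = ∫ x, f.1 x * ∫ y, g.1 y / ‖x - y‖ := rfl

theorem interaction_comm (f g : boundedPotential) : interaction f g = interaction g f := by
  rw [interaction_apply, interaction_apply]
  simp only [← integral_const_mul]
  rw [integral_integral_swap (integrable_coulomb f.2 g.2)]
  congr 1; ext x
  congr 1; ext y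
  rw [norm_sub_rev]
  ring

theorem abs_interaction_le (f g : boundedPotential) {L K : ℝ} (hL : ∫ x, |f.1 x| ≤ L)
    (hK : ∀ x, ∫ y, |g.1 y| / ‖x - y‖ ≤ K) : |interaction f g| ≤ L * K := by
  have hK0 : 0 ≤ K := (integral_nonneg fun y => by positivity).trans (hK 0)
  rw [interaction_apply, ← Real.norm_eq_abs]
  refine (norm_integral_le_integral_norm _).trans ?_
  refine le_trans ?_ (mul_le_mul_of_nonneg_right hL hK0)
  rw [← integral_mul_const]
  refine integral_mono_of_nonneg (Eventually.of_forall fun x => norm_nonneg _)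
    (f.2.1.abs.mul_const K) (Eventually.of_forall fun x => ?_)
  simp only [norm_mul, Real.norm_eq_abs]
  refine mul_le_mul_of_nonneg_left ?_ (abs_nonneg _)
  rw [← Real.norm_eq_abs]
  refine (norm_integral_le_integral_norm _).trans (le_trans (le_of_eq ?_) (hK x))
  simp only [norm_div, Real.norm_eq_abs, abs_norm]

theorem interaction_congr_ae {f g f' g' : boundedPotential} (hf : f.1 =ᵐ[volume] f'.1)
    (hg : g.1 =ᵐ[volume] g'.1) : interaction f g = interaction f' g' := by
  rw [interaction_apply, interaction_apply]
  refine integral_congr_ae ?_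
  filter_upwards [hf] with x hx
  rw [hx]
  congr 1
  refine integral_congr_ae ?_
  filter_upwards [hg] with y hy
  rw [hy]

/-- The function `Re (u v̄)`. -/
noncomputable def reMul (u v : H1) (x : E3) : ℝ := (fn u x * conj (fn v x)).re

@[fun_prop]
theorem measurable_reMul (u v : H1) : Measurable (reMul u v) :=
  Complex.measurable_re.comp ((measurable_fn u).mul
    (Complex.continuous_conj.measurable.comp (measurable_fn v)))

theorem abs_reMul_le (u v : H1) (x : E3) : |reMul u v x| ≤ ‖fn u x‖ * ‖fn v x‖ := by
  refine (Complex.abs_re_le_norm _).trans_eq ?_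
  rw [norm_mul, RCLike.norm_conj]

/-- The free weight plays the role of the Cauchy–Schwarz inequality: taken of the size of `v`, it
makes both terms of first order in `v`. -/
theorem abs_reMul_le_of_pos (u v : H1) (x : E3) {δ : ℝ} (hδ : 0 < δ) :
    |reMul u v x| ≤ δ * ‖fn u x‖ ^ 2 + δ⁻¹ * ‖fn v x‖ ^ 2 := by
  refine (abs_reMul_le u v x).trans ?_
  have h := two_mul_le_add_sq (δ * ‖fn u x‖) ‖fn v x‖
  have h2 : 0 ≤ ‖fn u x‖ * ‖fn v x‖ := by positivity
  have e : δ * ‖fn u x‖ ^ 2 + δ⁻¹ * ‖fn v x‖ ^ 2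
      = δ⁻¹ * ((δ * ‖fn u x‖) ^ 2 + ‖fn v x‖ ^ 2) := by field_simp
  rw [e, inv_mul_eq_div, le_div_iff₀ hδ]
  nlinarith

theorem integrable_reMul (u v : H1) : Integrable (reMul u v) :=
  ((integrable_norm_sq u).const_mul 1 |>.add ((integrable_norm_sq v).const_mul 1⁻¹)).mono'
    (by fun_prop) (Eventually.of_forall fun x => abs_reMul_le_of_pos u v x one_pos)

theorem integral_abs_reMul_le (u v : H1) {δ : ℝ} (hδ : 0 < δ) :
    ∫ x, |reMul u v x| ≤ δ * mass u + δ⁻¹ * mass v := by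
  rw [mass, mass, ← integral_const_mul, ← integral_const_mul,
    ← integral_add ((integrable_norm_sq u).const_mul _) ((integrable_norm_sq v).const_mul _)]
  exact integral_mono (integrable_reMul u v).abs
    (((integrable_norm_sq u).const_mul _).add ((integrable_norm_sq v).const_mul _))
    fun x => abs_reMul_le_of_pos u v x hδ

theorem integrable_reMul_div (u v : H1) (x : E3) :
    Integrable fun y => reMul u v y / ‖x - y‖ := by
  refine (((integrable_potential u x).const_mul 1).add
    ((integrable_potential v x).const_mul 1⁻¹)).mono'
    (by exact Measurable.aestronglyMeasurable (by fun_prop))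
    (Eventually.of_forall fun y => ?_)
  rw [norm_div, norm_norm, Real.norm_eq_abs]
  simp only [Pi.add_apply, ← mul_div_assoc, ← add_div]
  gcongr
  exact abs_reMul_le_of_pos u v y one_pos

theorem integral_abs_reMul_div_le (u v : H1) (x : E3) {δ : ℝ} (hδ : 0 < δ) :
    ∫ y, |reMul u v y| / ‖x - y‖ ≤ δ * potential u x + δ⁻¹ * potential v x := by
  rw [potential, potential, ← integral_const_mul, ← integral_const_mul,
    ← integral_add ((integrable_potential u x).const_mul _)
      ((integrable_potential v x).const_mul _)]
  refine integral_mono_of_nonneg (Eventually.of_forall fun y => by positivity)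
    (((integrable_potential u x).const_mul _).add ((integrable_potential v x).const_mul _))
    (Eventually.of_forall fun y => ?_)
  simp only [← mul_div_assoc, ← add_div]
  gcongr
  exact abs_reMul_le_of_pos u v y hδ

theorem reMul_mem_boundedPotential (u v : H1) : reMul u v ∈ boundedPotential :=
  ⟨integrable_reMul u v, integrable_reMul_div u v, by
    obtain ⟨K, _, hK⟩ := exists_potential_le
    refine ⟨K * ‖u‖ ^ 2 + K * ‖v‖ ^ 2, fun x =>
      (integral_abs_reMul_div_le u v x one_pos).trans ?_⟩
    rw [one_mul, inv_one, one_mul]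
    exact add_le_add (hK u x) (hK v x)⟩

/-- `Re (u v̄)` as a density of bounded potential. -/
noncomputable def density (u v : H1) : boundedPotential :=
  ⟨reMul u v, reMul_mem_boundedPotential u v⟩

theorem coe_density (u v : H1) : (density u v : E3 → ℝ) = reMul u v := rfl

theorem reMul_self (u : H1) (x : E3) : reMul u u x = ‖fn u x‖ ^ 2 := by
  rw [reMul, Complex.mul_conj, Complex.ofReal_re, Complex.normSq_eq_norm_sq]

theorem coulomb_eq_interaction (u : H1) :
    coulomb u = interaction (density u u) (density u u) := by
  simp only [interaction_apply, coe_density, reMul_self, coulomb, ← integral_const_mul,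
    mul_div_assoc]

theorem interaction_density_left (u v : H1) :
    interaction (density u v) (density u u) = ∫ x, reMul u v x * potential u x := by
  simp only [interaction_apply, coe_density, reMul_self, potential]

/-- The remainder in the expansion of the Coulomb energy of `u + h` to first order. -/
theorem coulomb_add (u h : H1) : coulomb (u + h) = coulomb u
    + 4 * interaction (density u h) (density u u)
    + (2 * interaction (density u u) (density h h) + 4 * interaction (density u h) (density u h)
      + 4 * interaction (density u h) (density h h) + interaction (density h h) (density h h)) := by
  have he : (density (u + h) (u + h)).1 =ᵐ[volume]
      (density u u + (2 : ℝ) • density u h + density h h : boundedPotential).1 := by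
    filter_upwards [fn_add u h] with x hx
    simp only [coe_density, Submodule.coe_add, Submodule.coe_smul, Pi.add_apply, Pi.smul_apply,
      reMul, hx, smul_eq_mul, map_add]
    simp only [Complex.add_re, Complex.mul_re, Complex.conj_re, Complex.conj_im,
      Complex.add_im]
    ring
  rw [coulomb_eq_interaction, coulomb_eq_interaction, interaction_congr_ae he he]
  simp only [map_add, map_smul, LinearMap.add_apply, LinearMap.smul_apply, smul_eq_mul]
  rw [interaction_comm (density u u) (density u h), interaction_comm (density h h) (density u h),
    interaction_comm (density h h) (density u u)]
  ring

/-- Each interaction is bounded by the `L¹` norm of one density times the supremum of the potential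
of the other. The parameters serve two regimes: `h` small in `H¹` with `τ = ‖h‖` and `σ` of order
`τ`, where the remainder is quadratic; and `h` spread out, with mass bounded but not small, where
only `τ` tends to zero. -/
theorem abs_coulomb_remainder_le (u h : H1) {L τ σ : ℝ} (hτ : 0 < τ) (hτ1 : τ ≤ 1)
    (hmu : mass u ≤ L) (hmh : mass h ≤ L) (hσ : ∫ x, |reMul u h x| ≤ σ)
    (hpu : ∀ x, potential u x ≤ L) (hph : ∀ x, potential h x ≤ τ ^ 2 * L) :
    |interaction (density u h) (density u u)| ≤ 2 * L ^ 2 * τ ∧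
    |2 * interaction (density u u) (density h h) + 4 * interaction (density u h) (density u h)
      + 4 * interaction (density u h) (density h h) + interaction (density h h) (density h h)|
      ≤ 3 * L ^ 2 * τ ^ 2 + 12 * σ * L * τ := by
  have habs : ∀ v : H1, ∀ x, |(density v v).1 x| = ‖fn v x‖ ^ 2 := fun v x => by
    rw [coe_density, reMul_self, abs_of_nonneg (by positivity)]
  have hσ0 : 0 ≤ σ := (integral_nonneg fun x => abs_nonneg _).trans hσ
  have hL0 : 0 ≤ L := (potential_nonneg u 0).trans (hpu 0)
  have h1 : ∀ v : H1, mass v ≤ L → ∫ x, |(density v v).1 x| ≤ L := fun v hv => by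
    simp only [habs]; exact hv
  have h2 : ∀ x, ∫ y, |(density h h).1 y| / ‖x - y‖ ≤ τ ^ 2 * L := fun x => by
    simp only [habs]; exact hph x
  have h3 : ∀ x, ∫ y, |(density u h).1 y| / ‖x - y‖ ≤ 2 * τ * L := fun x => by
    refine (integral_abs_reMul_div_le u h x hτ).trans ?_
    have := mul_le_mul_of_nonneg_left (hpu x) hτ.le
    have := mul_le_mul_of_nonneg_left (hph x) (inv_pos.2 hτ).le
    have e : τ⁻¹ * (τ ^ 2 * L) = τ * L := by field_simp
    linarith
  have b0 := abs_interaction_le (density u u) (density u h) (h1 u hmu) h3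
  have b1 := abs_interaction_le (density u u) (density h h) (h1 u hmu) h2
  have b2 := abs_interaction_le (density u h) (density u h) hσ h3
  have b3 := abs_interaction_le (density u h) (density h h) hσ h2
  have b4 := abs_interaction_le (density h h) (density h h) (h1 h hmh) h2
  constructor
  · rw [interaction_comm]
    linarith
  · have b3' : σ * (τ ^ 2 * L) ≤ σ * L * τ := by
      have : 0 ≤ σ * L * τ * (1 - τ) :=
        mul_nonneg (mul_nonneg (mul_nonneg hσ0 hL0) hτ.le) (by linarith)
      linarith
    rw [abs_le] at b1 b2 b3 b4 ⊢
    constructor <;> linarith [b1.1, b1.2, b2.1, b2.2, b3.1, b3.2, b4.1, b4.2]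

/-! ### Pointwise inequalities for powers -/

theorem rpow_add_mul_sub_le {a b q : ℝ} (ha : 0 ≤ a) (hb : 0 ≤ b) (hq : 1 ≤ q) :
    a ^ q + q * a ^ (q - 1) * (b - a) ≤ b ^ q := by
  rcases ha.eq_or_lt with rfl | ha
  · rcases hq.eq_or_lt with rfl | hq
    · simp
    · rw [Real.zero_rpow (by linarith), Real.zero_rpow (by linarith)]
      simpa using Real.rpow_nonneg hb q
  · have h := one_add_mul_self_le_rpow_one_add (s := b / a - 1)
      (by linarith [div_nonneg hb ha.le]) hq
    rw [add_sub_cancel, Real.div_rpow hb ha.le, le_div_iff₀ (by positivity)] at h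
    refine le_trans (le_of_eq ?_) h
    rw [Real.rpow_sub_one ha.ne']
    field_simp

theorem abs_rpow_sub_rpow_le {a b M q : ℝ} (ha : 0 ≤ a) (hb : 0 ≤ b) (haM : a ≤ M) (hbM : b ≤ M)
    (hq : 1 ≤ q) : |a ^ q - b ^ q| ≤ q * M ^ (q - 1) * |a - b| := by
  have key : ∀ {a b : ℝ}, 0 ≤ a → 0 ≤ b → b ≤ a → a ≤ M →
      |a ^ q - b ^ q| ≤ q * M ^ (q - 1) * |a - b| := by
    intro a b ha hb hba haM
    have h1 := rpow_add_mul_sub_le ha hb hq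
    have h2 : a ^ (q - 1) ≤ M ^ (q - 1) := Real.rpow_le_rpow ha haM (by linarith)
    have h3 : b ^ q ≤ a ^ q := Real.rpow_le_rpow hb hba (by linarith)
    rw [abs_of_nonneg (by linarith), abs_of_nonneg (by linarith)]
    have : q * a ^ (q - 1) * (a - b) ≤ q * M ^ (q - 1) * (a - b) := by
      have := sub_nonneg.2 hba
      gcongr
    linarith
  rcases le_total b a with h | h
  · exact key ha hb h haM
  · rw [abs_sub_comm, abs_sub_comm a b]
    exact key hb ha h hbM

/-- Convexity of `z ↦ ‖z‖ ^ p`: its graph lies above its tangent plane. -/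
theorem norm_rpow_add_le {p : ℝ} (hp : 2 < p) (z h : ℂ) :
    ‖z‖ ^ p + p * (‖z‖ ^ (p - 2) * (z * conj h).re) ≤ ‖z + h‖ ^ p := by
  refine le_trans ?_ (rpow_add_mul_sub_le (norm_nonneg z) (norm_nonneg (z + h)) (by linarith))
  have h1 : (z * conj h).re ≤ ‖z‖ * (‖z + h‖ - ‖z‖) := by
    have e : (z * conj h).re = (z * conj (z + h)).re - ‖z‖ ^ 2 := by
      rw [map_add, mul_add, Complex.add_re, Complex.mul_conj, Complex.ofReal_re,
        Complex.normSq_eq_norm_sq]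
      ring
    have h2 := Complex.re_le_norm (z * conj (z + h))
    rw [norm_mul, RCLike.norm_conj] at h2
    rw [e]
    linarith
  have h2 : ‖z‖ ^ (p - 1) = ‖z‖ ^ (p - 2) * ‖z‖ := by
    rcases eq_or_ne z 0 with rfl | hz
    · rw [norm_zero, mul_zero, Real.zero_rpow (by linarith)]
    · rw [← Real.rpow_add_one (norm_ne_zero_iff.2 hz)]; ring_nf
  rw [h2, mul_assoc, mul_assoc]
  have : 0 ≤ ‖z‖ ^ (p - 2) := by positivity
  gcongr

/-- The convexity bound is applied at `z + h` with increment `-h`. It remains to move the gradient's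
weight from `z + h` back to `z`, by the Lipschitz estimate for `a ↦ a ^ (p - 2)`; this is why `3 ≤
p` is assumed. -/
theorem norm_add_rpow_le {p : ℝ} (hp : 3 ≤ p) (z h : ℂ) :
    ‖z + h‖ ^ p ≤ ‖z‖ ^ p + p * (‖z‖ ^ (p - 2) * (z * conj h).re)
      + p * (p - 1) * ((‖z‖ + ‖h‖) ^ (p - 2) * ‖h‖ ^ 2) := by
  set M := ‖z‖ + ‖h‖ with hM
  have hzM : ‖z‖ ≤ M := le_add_of_nonneg_right (norm_nonneg h)
  have hM0 : 0 ≤ M := (norm_nonneg z).trans hzM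
  have h1 := norm_rpow_add_le (by linarith : 2 < p) (z + h) (-h)
  rw [add_neg_cancel_right, map_neg, mul_neg, Complex.neg_re, add_mul, Complex.add_re,
    Complex.mul_conj h, Complex.ofReal_re, Complex.normSq_eq_norm_sq] at h1
  have h2 := abs_rpow_sub_rpow_le (q := p - 2) (norm_nonneg (z + h)) (norm_nonneg z)
    (norm_add_le z h) hzM (by linarith)
  have h3 : |‖z + h‖ - ‖z‖| ≤ ‖h‖ := by
    have := abs_norm_sub_norm_le (z + h) z
    rwa [add_sub_cancel_left] at this
  have h4 : |(z * conj h).re| ≤ ‖z‖ * ‖h‖ := by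
    refine (Complex.abs_re_le_norm _).trans_eq ?_
    rw [norm_mul, RCLike.norm_conj]
  have hMp : M ^ (p - 2 - 1) * ‖z‖ ≤ M ^ (p - 2) := by
    rcases hM0.eq_or_lt with h0 | h0
    · have : ‖z‖ = 0 := le_antisymm (h0 ▸ hzM) (norm_nonneg z)
      rw [this, mul_zero]
      positivity
    · rw [Real.rpow_sub_one h0.ne', div_mul_eq_mul_div, div_le_iff₀ h0]
      exact mul_le_mul_of_nonneg_left hzM (by positivity)
  have h5 : (‖z + h‖ ^ (p - 2) - ‖z‖ ^ (p - 2)) * (z * conj h).re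
      ≤ (p - 2) * (M ^ (p - 2) * ‖h‖ ^ 2) := by
    calc (‖z + h‖ ^ (p - 2) - ‖z‖ ^ (p - 2)) * (z * conj h).re
        ≤ |‖z + h‖ ^ (p - 2) - ‖z‖ ^ (p - 2)| * |(z * conj h).re| := by
          rw [← abs_mul]; exact le_abs_self _
      _ ≤ ((p - 2) * M ^ (p - 2 - 1) * ‖h‖) * (‖z‖ * ‖h‖) := by
          have hp2 : 0 ≤ p - 2 := by linarith
          refine mul_le_mul (h2.trans ?_) h4 (abs_nonneg _) (by positivity)
          exact mul_le_mul_of_nonneg_left h3 (by positivity)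
      _ = (p - 2) * ((M ^ (p - 2 - 1) * ‖z‖) * ‖h‖ ^ 2) := by ring
      _ ≤ _ := by
          have hp2 : 0 ≤ p - 2 := by linarith
          gcongr
  have h6 : ‖z + h‖ ^ (p - 2) * ‖h‖ ^ 2 ≤ M ^ (p - 2) * ‖h‖ ^ 2 :=
    mul_le_mul_of_nonneg_right
      (Real.rpow_le_rpow (norm_nonneg _) (norm_add_le z h) (by linarith)) (by positivity)
  have hp0 : 0 ≤ p := by linarith
  have h7 := mul_le_mul_of_nonneg_left (add_le_add h5 h6) hp0
  linarith

/-- Young's inequality in the form used to bound mixed powers. -/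
theorem rpow_mul_rpow_le {a b τ p k : ℝ} (ha : 0 ≤ a) (hb : 0 ≤ b) (hτ : 0 < τ) (hk : 0 < k)
    (hkp : k ≤ p) : a ^ (p - k) * b ^ k ≤ τ ^ k * (a ^ p + (b / τ) ^ p) := by
  have hc : 0 ≤ b / τ := by positivity
  obtain ⟨c, rfl⟩ : ∃ c, b = τ * c := ⟨b / τ, by field_simp⟩
  have e : τ * c / τ = c := by field_simp
  rw [e] at hc ⊢
  rw [Real.mul_rpow hτ.le hc, mul_left_comm]
  refine mul_le_mul_of_nonneg_left ?_ (by positivity)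
  rcases le_total a c with h | h
  · calc a ^ (p - k) * c ^ k ≤ c ^ (p - k) * c ^ k :=
          mul_le_mul_of_nonneg_right (Real.rpow_le_rpow ha h (by linarith)) (by positivity)
      _ = c ^ p := by
          rcases hc.eq_or_lt with rfl | h0
          · rw [Real.zero_rpow hk.ne', Real.zero_rpow (hk.trans_le hkp).ne', mul_zero]
          · rw [← Real.rpow_add h0, sub_add_cancel]
      _ ≤ _ := le_add_of_nonneg_left (by positivity)
  · calc a ^ (p - k) * c ^ k ≤ a ^ (p - k) * a ^ k :=
          mul_le_mul_of_nonneg_left (Real.rpow_le_rpow hc h hk.le) (by positivity)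
      _ = a ^ p := by
          rcases ha.eq_or_lt with rfl | h0
          · rw [Real.zero_rpow hk.ne', Real.zero_rpow (hk.trans_le hkp).ne', mul_zero]
          · rw [← Real.rpow_add h0, sub_add_cancel]
      _ ≤ _ := le_add_of_nonneg_right (by positivity)

theorem add_rpow_le {a b p : ℝ} (ha : 0 ≤ a) (hb : 0 ≤ b) (hp : 0 ≤ p) :
    (a + b) ^ p ≤ 2 ^ p * (a ^ p + b ^ p) := by
  have h1 : 0 ≤ a ^ p := by positivity
  have h2 : 0 ≤ b ^ p := by positivity
  have h : ∀ m, 0 ≤ m → a ≤ m → b ≤ m → m ^ p ≤ a ^ p + b ^ p →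
      (a + b) ^ p ≤ 2 ^ p * (a ^ p + b ^ p) := fun m hm ham hbm hle =>
    calc (a + b) ^ p ≤ (2 * m) ^ p := Real.rpow_le_rpow (by positivity) (by linarith) hp
      _ = 2 ^ p * m ^ p := Real.mul_rpow zero_le_two hm
      _ ≤ _ := by gcongr
  rcases le_total a b with hab | hab
  · exact h b hb hab le_rfl (by linarith)
  · exact h a ha le_rfl hab (by linarith)

/-! ### Differentiability of the energy on `H¹` -/

theorem hasFDerivAt_of_sq_bound {E : Type*} [NormedAddCommGroup E] [NormedSpace ℝ E] {f : E → ℝ}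
    {L : E →L[ℝ] ℝ} {u : E} (M : ℝ)
    (hM : ∀ h, ‖h‖ ≤ 1 → |f (u + h) - f u - L h| ≤ M * ‖h‖ ^ 2) : HasFDerivAt f L u := by
  rw [hasFDerivAt_iff_isLittleO_nhds_zero]
  have h1 : (fun h => f (u + h) - f u - L h) =O[𝓝 0] fun h => ‖h‖ ^ 2 := by
    refine Asymptotics.IsBigO.of_bound M ?_
    filter_upwards [Metric.closedBall_mem_nhds (0 : E) one_pos] with h hh
    rw [norm_pow, norm_norm, Real.norm_eq_abs]
    exact hM h (by simpa using hh)
  exact h1.trans_isLittleO (Asymptotics.isLittleO_norm_pow_id one_lt_two)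

/-- `v ↦ Re ∫ w v̄` as a continuous linear functional. -/
noncomputable def rePairing (w : E3 → ℂ) (hw : ∀ v : H1, Integrable fun x => w x * conj (fn v x))
    (C : ℝ) (hC : ∀ v : H1, ∫ x, |(w x * conj (fn v x)).re| ≤ C * ‖v‖) : H1 →L[ℝ] ℝ :=
  LinearMap.mkContinuous
    { toFun := fun v => (∫ x, w x * conj (fn v x)).re
      map_add' := fun u v => by
        rw [← Complex.add_re, ← integral_add (hw u) (hw v)]
        congr 1
        refine integral_congr_ae ?_
        filter_upwards [fn_add u v] with x hx
        rw [hx, map_add, mul_add]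
      map_smul' := fun t v => by
        rw [RingHom.id_apply, smul_eq_mul, ← Complex.re_ofReal_mul, ← integral_const_mul]
        congr 1
        refine integral_congr_ae ?_
        filter_upwards [fn_real_smul t v] with x hx
        rw [hx, map_mul, Complex.conj_ofReal, mul_left_comm] } C fun v => by
    refine le_trans ?_ (hC v)
    have : (∫ x, w x * conj (fn v x)).re = ∫ x, (w x * conj (fn v x)).re :=
      (Complex.reCLM.integral_comp_comm (hw v)).symm
    simp only [LinearMap.coe_mk, AddHom.coe_mk, this]
    exact norm_integral_le_integral_norm _

theorem re_integral_mul_conj {w : E3 → ℂ} {v : H1} (hw : Integrable fun x => w x * conj (fn v x)) :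
    (∫ x, w x * conj (fn v x)).re = ∫ x, (w x * conj (fn v x)).re :=
  (Complex.reCLM.integral_comp_comm hw).symm

@[fun_prop]
theorem measurable_conj_fn (u : H1) : Measurable fun x => conj (fn u x) :=
  Complex.continuous_conj.measurable.comp (measurable_fn u)

theorem integrable_fn_mul_conj (u v : H1) : Integrable fun x => fn u x * conj (fn v x) := by
  refine ((integrable_norm_sq u).add (integrable_norm_sq v)).mono'
    (by exact Measurable.aestronglyMeasurable (by fun_prop)) (Eventually.of_forall fun x => ?_)
  rw [norm_mul, RCLike.norm_conj]
  have := two_mul_le_add_sq ‖fn u x‖ ‖fn v x‖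
  have : 0 ≤ ‖fn u x‖ * ‖fn v x‖ := by positivity
  simp only [Pi.add_apply]
  nlinarith

theorem stronglyMeasurable_potential (u : H1) : StronglyMeasurable (potential u) := by
  have : Measurable fun z : E3 × E3 => ‖fn u z.2‖ ^ 2 / ‖z.1 - z.2‖ := by fun_prop
  exact this.stronglyMeasurable.integral_prod_right'

theorem integrable_potential_mul (u v : H1) :
    Integrable fun x => (potential u x : ℂ) * fn u x * conj (fn v x) := by
  obtain ⟨K, _, hK⟩ := exists_potential_le
  simp only [mul_assoc]
  refine (integrable_fn_mul_conj u v).bdd_mul (c := K * ‖u‖ ^ 2)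
    (Complex.measurable_ofReal.comp (stronglyMeasurable_potential u).measurable).aestronglyMeasurable
    (Eventually.of_forall fun x => ?_)
  rw [Complex.norm_real, Real.norm_of_nonneg (potential_nonneg u x)]
  exact hK u x

theorem integral_abs_reMul_le_norm (u v : H1) :
    ∫ x, |reMul u v x| ≤ (mass u + 1) * ‖v‖ := by
  rcases eq_or_ne v 0 with rfl | hv
  · rw [norm_zero, mul_zero]
    refine (integral_eq_zero_of_ae ?_).le
    filter_upwards [fn_zero] with x hx
    simp [reMul, hx]
  · have hτ : 0 < ‖v‖ := norm_pos_iff.2 hv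
    refine (integral_abs_reMul_le u v hτ).trans ?_
    have : mass v ≤ ‖v‖ ^ 2 := by
      rw [mass_eq]
      exact pow_le_pow_left₀ (norm_nonneg _) (norm_fst_le v) 2
    have : ‖v‖⁻¹ * mass v ≤ ‖v‖ := by
      rw [inv_mul_le_iff₀ hτ]; linarith
    linarith

theorem norm_power_term {p : ℝ} (hp : 2 < p) (u v : H1) (x : E3) :
    ‖((‖fn u x‖ ^ (p - 2) : ℝ) : ℂ) * fn u x * conj (fn v x)‖ = ‖fn u x‖ ^ (p - 1) * ‖fn v x‖ := by
  rw [norm_mul, norm_mul, RCLike.norm_conj, Complex.norm_real, Real.norm_of_nonneg (by positivity)]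
  congr 1
  rcases eq_or_ne (fn u x) 0 with hz | hz
  · rw [hz, norm_zero, mul_zero, Real.zero_rpow (by linarith)]
  · rw [← Real.rpow_add_one (norm_ne_zero_iff.2 hz)]; ring_nf

theorem norm_power_term_le {p τ : ℝ} (hp : 2 < p) (hτ : 0 < τ) (u v : H1) (x : E3) :
    ‖((‖fn u x‖ ^ (p - 2) : ℝ) : ℂ) * fn u x * conj (fn v x)‖
      ≤ τ * (‖fn u x‖ ^ p + (τ ^ p)⁻¹ * ‖fn v x‖ ^ p) := by
  rw [norm_power_term hp]
  have := rpow_mul_rpow_le (norm_nonneg (fn u x)) (norm_nonneg (fn v x)) hτ one_pos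
    (by linarith : 1 ≤ p)
  rwa [Real.rpow_one, Real.rpow_one, Real.div_rpow (norm_nonneg _) hτ.le, div_eq_inv_mul] at this

theorem integrable_power_term {p : ℝ} (hp : 2 < p) (hp6 : p ≤ 6) (u v : H1) :
    Integrable fun x => ((‖fn u x‖ ^ (p - 2) : ℝ) : ℂ) * fn u x * conj (fn v x) := by
  have hm : Measurable fun x => ‖fn u x‖ ^ (p - 2) := (measurable_fn u).norm.pow_const _
  refine (((integrable_norm_rpow hp.le hp6 u).add
    ((integrable_norm_rpow hp.le hp6 v).const_mul (1 ^ p)⁻¹)).const_mul 1).mono'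
    (by exact Measurable.aestronglyMeasurable (by fun_prop)) (Eventually.of_forall fun x => ?_)
  exact norm_power_term_le hp one_pos u v x

theorem exists_integral_power_term_le {p : ℝ} (hp : 2 < p) (hp6 : p ≤ 6) (u : H1) : ∃ C, ∀ v : H1,
    ∫ x, |(((‖fn u x‖ ^ (p - 2) : ℝ) : ℂ) * fn u x * conj (fn v x)).re| ≤ C * ‖v‖ := by
  obtain ⟨K, hK0, hK⟩ := exists_power_le hp.le hp6
  refine ⟨power p u + K, fun v => ?_⟩
  rcases eq_or_ne v 0 with rfl | hv
  · rw [norm_zero, mul_zero]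
    refine (integral_eq_zero_of_ae ?_).le
    filter_upwards [fn_zero] with x hx
    simp [hx]
  · have hτ : 0 < ‖v‖ := norm_pos_iff.2 hv
    have hi := ((integrable_norm_rpow hp.le hp6 u).add
      ((integrable_norm_rpow hp.le hp6 v).const_mul (‖v‖ ^ p)⁻¹)).const_mul ‖v‖
    refine (integral_mono (integrable_power_term hp hp6 u v).re.abs hi fun x =>
      (Complex.abs_re_le_norm _).trans (norm_power_term_le hp hτ u v x)).trans ?_
    simp only [Pi.add_apply]
    rw [integral_const_mul, integral_add (integrable_norm_rpow hp.le hp6 u)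
      ((integrable_norm_rpow hp.le hp6 v).const_mul _), integral_const_mul, mul_comm]
    refine mul_le_mul_of_nonneg_right (add_le_add le_rfl ?_) hτ.le
    rw [inv_mul_le_iff₀ (by positivity), mul_comm]
    exact hK v

theorem reInner_eq (u v : H1) : reInner u v = ∫ x, reMul u v x :=
  re_integral_mul_conj (integrable_fn_mul_conj u v)

theorem mass_add (u h : H1) : mass (u + h) = mass u + 2 * reInner u h + mass h := by
  have hi : Integrable fun x => ‖fn u x‖ ^ 2 + 2 * reMul u h x :=
    (integrable_norm_sq u).add ((integrable_reMul u h).const_mul 2)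
  rw [reInner_eq, mass, mass, mass, ← integral_const_mul,
    ← integral_add (integrable_norm_sq u) ((integrable_reMul u h).const_mul 2),
    ← integral_add hi (integrable_norm_sq h)]
  refine integral_congr_ae ?_
  filter_upwards [fn_add u h] with x hx
  rw [hx, ← reMul_self u, ← reMul_self h, ← Complex.normSq_eq_norm_sq, Complex.normSq_apply]
  simp only [reMul, Complex.add_re, Complex.mul_re, Complex.conj_re, Complex.conj_im,
      Complex.add_im]
  ring

/-- `Re (u, ·)₂` as a continuous linear functional. -/
noncomputable def reInnerCLM (u : H1) : H1 →L[ℝ] ℝ :=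
  rePairing (fn u) (integrable_fn_mul_conj u) (mass u + 1) (integral_abs_reMul_le_norm u)

theorem reInnerCLM_apply (u v : H1) : reInnerCLM u v = reInner u v := rfl

/-- The pairing `∫ ∇u · ∇v̄`. -/
noncomputable def gradInner (u v : H1) : ℂ := ∫ x, ∑ i, grad u x i * conj (grad v x i)

theorem inner_grad (u v : H1) (x : E3) :
    inner ℂ (grad v x) (grad u x) = ∑ i, grad u x i * conj (grad v x i) := by
  simp [PiLp.inner_apply]

theorem integrable_grad_mul_conj (u v : H1) :
    Integrable fun x => ∑ i, grad u x i * conj (grad v x i) := by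
  simp only [← inner_grad]
  exact L2.integrable_inner v.1.snd u.1.snd

theorem gradInner_eq (u v : H1) : gradInner u v = inner ℂ v.1.snd u.1.snd := by
  rw [L2.inner_def, gradInner]
  simp only [← inner_grad]
  rfl

theorem kinetic_add (u h : H1) :
    kinetic (u + h) = kinetic u + 2 * (gradInner u h).re + kinetic h := by
  rw [kinetic_eq, kinetic_eq, kinetic_eq, gradInner_eq]
  change ‖u.1.snd + h.1.snd‖ ^ 2 = _
  rw [norm_add_sq (𝕜 := ℂ), inner_re_symm]
  rfl

/-- `Re ∫ ∇u · ∇v̄` as a continuous linear functional of `v`. -/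
noncomputable def gradInnerCLM (u : H1) : H1 →L[ℝ] ℝ :=
  LinearMap.mkContinuous
    { toFun := fun v => (gradInner u v).re
      map_add' := fun v w => by
        simp only [gradInner_eq]
        rw [← Complex.add_re, ← inner_add_left]
        rfl
      map_smul' := fun t v => by
        simp only [gradInner_eq, RingHom.id_apply, smul_eq_mul]
        rw [← Complex.re_ofReal_mul, ← Complex.conj_ofReal t, ← inner_smul_left]
        rfl } ‖u.1.snd‖ fun v => by
    simp only [LinearMap.coe_mk, AddHom.coe_mk, gradInner_eq]
    refine (Complex.abs_re_le_norm _).trans ((norm_inner_le_norm _ _).trans ?_)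
    rw [mul_comm]
    exact mul_le_mul_of_nonneg_left (norm_snd_le v) (norm_nonneg _)

theorem gradInnerCLM_apply (u v : H1) : gradInnerCLM u v = (gradInner u v).re := rfl

theorem hasFDerivAt_kinetic (u : H1) : HasFDerivAt kinetic ((2 : ℝ) • gradInnerCLM u) u := by
  refine hasFDerivAt_of_sq_bound 1 fun h _ => ?_
  have e : kinetic (u + h) - kinetic u - ((2 : ℝ) • gradInnerCLM u) h = kinetic h := by
    change _ - _ - 2 * (gradInner u h).re = _
    rw [kinetic_add]
    ring
  rw [e, kinetic_eq, abs_of_nonneg (by positivity), one_mul]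
  exact pow_le_pow_left₀ (norm_nonneg _) (norm_snd_le h) 2

theorem exists_integral_potential_mul_le (u : H1) : ∃ C, ∀ v : H1,
    ∫ x, |((potential u x : ℂ) * fn u x * conj (fn v x)).re| ≤ C * ‖v‖ := by
  obtain ⟨K, hK0, hK⟩ := exists_potential_le
  refine ⟨K * ‖u‖ ^ 2 * (mass u + 1), fun v => ?_⟩
  rw [mul_assoc]
  refine le_trans ?_ (mul_le_mul_of_nonneg_left (integral_abs_reMul_le_norm u v)
    (by positivity : 0 ≤ K * ‖u‖ ^ 2))
  rw [← integral_const_mul]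
  refine integral_mono (integrable_potential_mul u v).re.abs
    ((integrable_reMul u v).abs.const_mul _) fun x => ?_
  change |((potential u x : ℂ) * fn u x * conj (fn v x)).re| ≤ _
  rw [mul_assoc, Complex.re_ofReal_mul, abs_mul, abs_of_nonneg (potential_nonneg u x)]
  exact mul_le_mul_of_nonneg_right (hK u x) (abs_nonneg _)

/-- `Re ∫ (|x|⁻¹ * |u|²) u v̄` as a continuous linear functional of `v`. -/
noncomputable def potentialCLM (u : H1) : H1 →L[ℝ] ℝ :=
  rePairing (fun x => (potential u x : ℂ) * fn u x) (integrable_potential_mul u)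
    (exists_integral_potential_mul_le u).choose (exists_integral_potential_mul_le u).choose_spec

theorem potentialCLM_apply (u v : H1) :
    potentialCLM u v = (∫ x, (potential u x : ℂ) * fn u x * conj (fn v x)).re := rfl

theorem potentialCLM_eq_interaction (u v : H1) :
    potentialCLM u v = interaction (density u v) (density u u) := by
  rw [potentialCLM_apply, interaction_density_left,
    re_integral_mul_conj (integrable_potential_mul u v)]
  congr 1; ext x
  rw [mul_assoc, Complex.re_ofReal_mul, mul_comm]
  rfl

theorem hasFDerivAt_coulomb (u : H1) : HasFDerivAt coulomb ((4 : ℝ) • potentialCLM u) u := by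
  obtain ⟨K, hK0, hK⟩ := exists_potential_le
  have hmu : 0 ≤ mass u := by rw [mass_eq]; positivity
  set L := 1 + mass u + K * ‖u‖ ^ 2 + K with hL
  have hu0 : 0 ≤ K * ‖u‖ ^ 2 := by positivity
  refine hasFDerivAt_of_sq_bound (3 * L ^ 2 + 12 * (mass u + 1) * L) fun h hh => ?_
  rcases eq_or_ne h 0 with rfl | h0
  · simp
  have e : coulomb (u + h) - coulomb u - ((4 : ℝ) • potentialCLM u) h =
      2 * interaction (density u u) (density h h) + 4 * interaction (density u h) (density u h)
      + 4 * interaction (density u h) (density h h) + interaction (density h h) (density h h) := by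
    change _ - _ - 4 * potentialCLM u h = _
    rw [coulomb_add, potentialCLM_eq_interaction]
    ring
  rw [e]
  have hτ : 0 < ‖h‖ := norm_pos_iff.2 h0
  have hmh : mass h ≤ ‖h‖ ^ 2 := by
    rw [mass_eq]
    exact pow_le_pow_left₀ (norm_nonneg _) (norm_fst_le h) 2
  have := (abs_coulomb_remainder_le u h (L := L) hτ hh (by linarith) (by nlinarith)
    (integral_abs_reMul_le_norm u h) (fun x => (hK u x).trans (by linarith))
    (fun x => (hK h x).trans (by nlinarith [sq_nonneg ‖h‖]))).2
  refine this.trans (le_of_eq ?_)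
  ring

/-- `Re ∫ |u|^{p-2} u v̄` as a continuous linear functional of `v`. -/
noncomputable def powerCLM {p : ℝ} (hp : 2 < p) (hp6 : p ≤ 6) (u : H1) : H1 →L[ℝ] ℝ :=
  rePairing (fun x => ((‖fn u x‖ ^ (p - 2) : ℝ) : ℂ) * fn u x) (integrable_power_term hp hp6 u)
    (exists_integral_power_term_le hp hp6 u).choose
    (exists_integral_power_term_le hp hp6 u).choose_spec

theorem powerCLM_apply {p : ℝ} (hp : 2 < p) (hp6 : p ≤ 6) (u v : H1) : powerCLM hp hp6 u v
    = (∫ x, ((‖fn u x‖ ^ (p - 2) : ℝ) : ℂ) * fn u x * conj (fn v x)).re := rfl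

theorem hasFDerivAt_power {p : ℝ} (hp : 3 ≤ p) (hp6 : p ≤ 6) (u : H1) :
    HasFDerivAt (power p) (p • powerCLM (by linarith) hp6 u) u := by
  have hp2 : 2 < p := by linarith
  obtain ⟨K, hK0, hK⟩ := exists_power_le hp2.le hp6
  refine hasFDerivAt_of_sq_bound (p * (p - 1) * (2 ^ p * (power p u + K) + K)) fun h hh => ?_
  have hiu := integrable_norm_rpow hp2.le hp6 u
  have hih := integrable_norm_rpow hp2.le hp6 h
  have hit : Integrable fun x => p * (‖fn u x‖ ^ (p - 2) * reMul u h x) := by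
    refine ((integrable_power_term hp2 hp6 u h).re.const_mul p).congr
      (Eventually.of_forall fun x => ?_)
    change p * (((‖fn u x‖ ^ (p - 2) : ℝ) : ℂ) * fn u x * conj (fn h x)).re = _
    rw [mul_assoc, Complex.re_ofReal_mul]
    rfl
  have hiuh : Integrable fun x => ‖fn u x + fn h x‖ ^ p := by
    refine (integrable_norm_rpow hp2.le hp6 (u + h)).congr ?_
    filter_upwards [fn_add u h] with x hx
    rw [hx]
  have e : power p (u + h) - power p u - (p • powerCLM hp2 hp6 u) h
      = ∫ x, (‖fn u x + fn h x‖ ^ p - ‖fn u x‖ ^ p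
        - p * (‖fn u x‖ ^ (p - 2) * reMul u h x)) := by
    have hi : Integrable fun x => ‖fn u x + fn h x‖ ^ p - ‖fn u x‖ ^ p := hiuh.sub hiu
    rw [integral_sub hi hit, integral_sub hiuh hiu]
    congr 1
    · congr 1
      refine integral_congr_ae ?_
      filter_upwards [fn_add u h] with x hx
      rw [hx]
    · change p * powerCLM hp2 hp6 u h = _
      rw [powerCLM_apply, re_integral_mul_conj (integrable_power_term hp2 hp6 u h),
        ← integral_const_mul]
      congr 1; ext x
      rw [mul_assoc _ (fn u x), Complex.re_ofReal_mul]
      rfl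
  rw [e]
  rcases eq_or_ne h 0 with rfl | h0
  · refine le_trans (le_of_eq ?_) (by simp : (0 : ℝ) ≤ _)
    rw [abs_eq_zero]
    refine integral_eq_zero_of_ae ?_
    filter_upwards [fn_zero] with x hx
    simp [reMul, hx]
  have hτ : 0 < ‖h‖ := norm_pos_iff.2 h0
  set τ := ‖h‖ with hτ_def
  -- Convexity makes the remainder nonnegative, so only an upper bound is needed.
  rw [abs_of_nonneg (integral_nonneg fun x => by
    have := norm_rpow_add_le hp2 (fn u x) (fn h x)
    simp only [Pi.zero_apply, reMul]
    linarith)]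
  have hpt : ∀ x, ‖fn u x + fn h x‖ ^ p - ‖fn u x‖ ^ p - p * (‖fn u x‖ ^ (p - 2) * reMul u h x)
      ≤ p * (p - 1) * (τ ^ 2 * (2 ^ p * (‖fn u x‖ ^ p + ‖fn h x‖ ^ p)
        + (τ ^ p)⁻¹ * ‖fn h x‖ ^ p)) := by
    intro x
    have h1 := norm_add_rpow_le hp (fn u x) (fn h x)
    -- Exponent `k = 2` and weight `τ = ‖h‖` extract the factor `τ ^ 2` that makes the remainder
    -- quadratic.
    have h2 := rpow_mul_rpow_le (a := ‖fn u x‖ + ‖fn h x‖) (b := ‖fn h x‖) (p := p) (k := 2)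
      (by positivity) (norm_nonneg _) hτ two_pos (by linarith)
    have h3 := add_rpow_le (norm_nonneg (fn u x)) (norm_nonneg (fn h x)) (by linarith : 0 ≤ p)
    rw [Real.div_rpow (norm_nonneg _) hτ.le, div_eq_inv_mul, Real.rpow_two, Real.rpow_two] at h2
    have h4 : 0 ≤ p * (p - 1) := mul_nonneg (by linarith) (by linarith)
    have h5 := mul_le_mul_of_nonneg_left (h2.trans (mul_le_mul_of_nonneg_left
      (add_le_add_left h3 _) (sq_nonneg τ))) h4
    simp only [reMul]
    linarith
  have hir : Integrable fun x => p * (p - 1) * (τ ^ 2 * (2 ^ p * (‖fn u x‖ ^ p + ‖fn h x‖ ^ p)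
        + (τ ^ p)⁻¹ * ‖fn h x‖ ^ p)) :=
    ((((hiu.add hih).const_mul _).add (hih.const_mul _)).const_mul _).const_mul _
  refine (integral_mono ((hiuh.sub hiu).sub hit) hir hpt).trans ?_
  have hia : Integrable fun x => 2 ^ p * (‖fn u x‖ ^ p + ‖fn h x‖ ^ p) :=
    (hiu.add hih).const_mul _
  rw [integral_const_mul, integral_const_mul, integral_add hia (hih.const_mul _),
    integral_const_mul, integral_const_mul, integral_add hiu hih]
  have h6 : 0 ≤ p * (p - 1) := mul_nonneg (by linarith) (by linarith)
  have h7 : power p h ≤ K := (hK h).trans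
    (mul_le_of_le_one_right hK0 (Real.rpow_le_one hτ.le hh (by linarith)))
  have h8 : (τ ^ p)⁻¹ * power p h ≤ K := by
    rw [inv_mul_le_iff₀ (by positivity), mul_comm]
    exact hK h
  have h9 : 2 ^ p * (power p u + power p h) + (τ ^ p)⁻¹ * power p h
      ≤ 2 ^ p * (power p u + K) + K := by gcongr
  calc _ = p * (p - 1) * (τ ^ 2 * (2 ^ p * (power p u + power p h)
        + (τ ^ p)⁻¹ * power p h)) := rfl
    _ ≤ p * (p - 1) * (τ ^ 2 * (2 ^ p * (power p u + K) + K)) := by gcongr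
    _ = _ := by ring

/-- The real part of the weak formulation without the multiplier term, which is the differential
of the energy. -/
noncomputable def energyDeriv {p : ℝ} (hp : 2 < p) (hp6 : p ≤ 6) (u : H1) : H1 →L[ℝ] ℝ :=
  gradInnerCLM u + potentialCLM u - powerCLM hp hp6 u

theorem hasFDerivAt_F {p : ℝ} (hp : 3 ≤ p) (hp6 : p ≤ 6) (u : H1) :
    HasFDerivAt (F p) (energyDeriv (by linarith) hp6 u) u := by
  have h := (((hasFDerivAt_kinetic u).const_mul (1 / 2)).add
    ((hasFDerivAt_coulomb u).const_mul (1 / 4))).sub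
      ((hasFDerivAt_power hp hp6 u).const_mul (1 / p))
  refine h.congr_fderiv ?_
  ext v
  simp only [energyDeriv, sub_apply, add_apply, smul_apply, smul_eq_mul]
  field_simp

/-! ### Mass-preserving dilations on `H¹` -/

theorem integral_comp_smul_three {E : Type*} [NormedAddCommGroup E] [NormedSpace ℝ E] (f : E3 → E)
    {t : ℝ} (ht : 0 < t) : ∫ x, f (t • x) = (t ^ 3)⁻¹ • ∫ x, f x := by
  rw [Measure.integral_comp_smul volume f t, abs_of_nonneg (by positivity)]
  simp

theorem memLp_comp_smul {E : Type*} [NormedAddCommGroup E] {f : E3 → E} {q : ℝ≥0∞} {t : ℝ}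
    (ht : 0 < t) (hf : MemLp f q volume) : MemLp (fun x => f (t • x)) q volume := by
  refine MemLp.comp_of_map (f := fun x : E3 => t • x) (g := f) ?_
    (measurable_const_smul t).aemeasurable
  rw [Measure.map_addHaar_smul _ ht.ne']
  exact hf.smul_measure ENNReal.ofReal_ne_top

theorem memLp_dilation_fst {t : ℝ} (ht : 0 < t) (u : H1) :
    MemLp (fun x => ((t ^ (3 / 2 : ℝ) : ℝ) : ℂ) • fn u (t • x)) 2 volume :=
  (memLp_comp_smul ht (memLp_two u)).const_smul ((t ^ (3 / 2 : ℝ) : ℝ) : ℂ)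

theorem memLp_dilation_snd {t : ℝ} (ht : 0 < t) (u : H1) :
    MemLp (fun x => ((t ^ (5 / 2 : ℝ) : ℝ) : ℂ) • grad u (t • x)) 2 volume :=
  (memLp_comp_smul ht (Lp.memLp u.1.snd)).const_smul ((t ^ (5 / 2 : ℝ) : ℝ) : ℂ)

/-- Change of variables, with the weak gradient of `u` tested on `y ↦ φ (t⁻¹ • y)`. The derivative
of this test function brings the extra `t` in `t^{5/2} = t^{3/2} t`. -/
theorem hasWeakGradient_dilation {t : ℝ} (ht : 0 < t) (u : H1) :
    HasWeakGradient ((memLp_dilation_fst ht u).toLp _) ((memLp_dilation_snd ht u).toLp _) := by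
  intro φ hφ hc i
  have hφ' : ContDiff ℝ ∞ fun y => φ (t⁻¹ • y) := hφ.comp (contDiff_const_smul _)
  have hc' : HasCompactSupport fun y => φ (t⁻¹ • y) :=
    hc.comp_homeomorph (Homeomorph.smulOfNeZero t⁻¹ (inv_ne_zero ht.ne'))
  have h := u.2 _ hφ' hc' i
  simp only [fderiv_comp_smul, smul_apply, smul_eq_mul, mul_smul] at h
  rw [integral_smul] at h
  have h1 : ∫ x, (fderiv ℝ φ x (EuclideanSpace.single i 1)) • ((memLp_dilation_fst ht u).toLp _) x
      = ((t ^ (3 / 2 : ℝ) : ℝ) : ℂ) • (t ^ 3)⁻¹ •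
        ∫ y, (fderiv ℝ φ (t⁻¹ • y) (EuclideanSpace.single i 1)) • fn u y := by
    rw [← integral_comp_smul_three _ ht, ← integral_smul]
    refine integral_congr_ae ?_
    filter_upwards [(memLp_dilation_fst ht u).coeFn_toLp] with x hx
    rw [hx, inv_smul_smul₀ ht.ne', smul_comm]
  have h2 : ∫ x, φ x • (((memLp_dilation_snd ht u).toLp _) x) i
      = ((t ^ (5 / 2 : ℝ) : ℝ) : ℂ) • (t ^ 3)⁻¹ • ∫ y, φ (t⁻¹ • y) • grad u y i := by
    rw [← integral_comp_smul_three (fun y => φ (t⁻¹ • y) • grad u y i) ht, ← integral_smul]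
    refine integral_congr_ae ?_
    filter_upwards [(memLp_dilation_snd ht u).coeFn_toLp] with x hx
    rw [hx, inv_smul_smul₀ ht.ne', PiLp.smul_apply, smul_comm]
  have h3 : ∫ y, (fderiv ℝ φ (t⁻¹ • y) (EuclideanSpace.single i 1)) • fn u y
      = - (t • ∫ y, φ (t⁻¹ • y) • grad u y i) := by
    rw [← smul_neg, ← smul_inv_smul₀ ht.ne' (∫ y, _ • fn u y)]
    exact congrArg (t • ·) h
  rw [h1, h2, h3]
  have e : t ^ (5 / 2 : ℝ) = t ^ (3 / 2 : ℝ) * t := by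
    rw [← Real.rpow_add_one ht.ne']; norm_num
  rw [e, smul_neg, smul_neg, smul_comm ((t ^ 3)⁻¹) t]
  simp only [Complex.real_smul, smul_eq_mul]
  push_cast
  ring

/-- The mass-preserving dilation `t^{3/2} u(t x)`. -/
noncomputable def dilation {t : ℝ} (ht : 0 < t) (u : H1) : H1 :=
  ⟨WithLp.toLp 2 ((memLp_dilation_fst ht u).toLp _, (memLp_dilation_snd ht u).toLp _),
    hasWeakGradient_dilation ht u⟩

theorem norm_fn_dilation {t : ℝ} (ht : 0 < t) (u : H1) :
    ∀ᵐ x, ‖fn (dilation ht u) x‖ = t ^ (3 / 2 : ℝ) * ‖fn u (t • x)‖ := by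
  filter_upwards [(memLp_dilation_fst ht u).coeFn_toLp] with x hx
  rw [show fn (dilation ht u) x = _ from hx, norm_smul, Complex.norm_real,
    Real.norm_of_nonneg (by positivity)]

theorem norm_sq_fn_dilation {t : ℝ} (ht : 0 < t) (u : H1) :
    ∀ᵐ x, ‖fn (dilation ht u) x‖ ^ 2 = t ^ 3 * ‖fn u (t • x)‖ ^ 2 := by
  filter_upwards [norm_fn_dilation ht u] with x hx
  rw [hx, mul_pow, ← Real.rpow_natCast (t ^ (3 / 2 : ℝ)), ← Real.rpow_mul ht.le]
  norm_num

theorem mass_dilation {t : ℝ} (ht : 0 < t) (u : H1) : mass (dilation ht u) = mass u := by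
  rw [mass, integral_congr_ae (norm_sq_fn_dilation ht u), integral_const_mul,
    integral_comp_smul_three (fun x => ‖fn u x‖ ^ 2) ht, smul_eq_mul,
    mul_inv_cancel_left₀ (by positivity)]
  rfl

theorem kinetic_dilation {t : ℝ} (ht : 0 < t) (u : H1) :
    kinetic (dilation ht u) = t ^ 2 * kinetic u := by
  have h : ∀ᵐ x, ‖grad (dilation ht u) x‖ ^ 2 = t ^ 5 * ‖grad u (t • x)‖ ^ 2 := by
    filter_upwards [(memLp_dilation_snd ht u).coeFn_toLp] with x hx
    rw [show grad (dilation ht u) x = _ from hx, norm_smul, Complex.norm_real,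
      Real.norm_of_nonneg (by positivity), mul_pow, ← Real.rpow_natCast (t ^ (5 / 2 : ℝ)),
      ← Real.rpow_mul ht.le]
    norm_num
  rw [kinetic, integral_congr_ae h, integral_const_mul,
    integral_comp_smul_three (fun x => ‖grad u x‖ ^ 2) ht, smul_eq_mul, kinetic]
  field_simp

theorem power_dilation {p : ℝ} {t : ℝ} (ht : 0 < t) (u : H1) :
    power p (dilation ht u) = t ^ (3 * (p - 2) / 2) * power p u := by
  have h : ∀ᵐ x, ‖fn (dilation ht u) x‖ ^ p = t ^ (3 / 2 * p) * ‖fn u (t • x)‖ ^ p := by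
    filter_upwards [norm_fn_dilation ht u] with x hx
    rw [hx, Real.mul_rpow (by positivity) (norm_nonneg _), ← Real.rpow_mul ht.le]
  rw [power, integral_congr_ae h, integral_const_mul,
    integral_comp_smul_three (fun x => ‖fn u x‖ ^ p) ht, smul_eq_mul, power, ← mul_assoc]
  congr 1
  rw [← Real.rpow_natCast, ← Real.rpow_neg ht.le, ← Real.rpow_add ht]
  congr 1
  push_cast
  ring

/-- Besides the scaling of the Coulomb energy, this shows that the potential tends to zero uniformly
as `t → 0`, although the mass is unchanged. -/
theorem potential_dilation {t : ℝ} (ht : 0 < t) (u : H1) (x : E3) :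
    potential (dilation ht u) x = t * potential u (t • x) := by
  have h : ∀ᵐ y, ‖fn (dilation ht u) y‖ ^ 2 / ‖x - y‖
      = t ^ 4 * (‖fn u (t • y)‖ ^ 2 / ‖t • x - t • y‖) := by
    filter_upwards [norm_sq_fn_dilation ht u] with y hy
    rw [hy, ← smul_sub, norm_smul, Real.norm_of_nonneg ht.le]
    field_simp
  rw [potential, integral_congr_ae h, integral_const_mul,
    integral_comp_smul_three (fun y => ‖fn u y‖ ^ 2 / ‖t • x - y‖) ht, smul_eq_mul, potential]
  field_simp

theorem coulomb_eq (u : H1) : coulomb u = ∫ x, ‖fn u x‖ ^ 2 * potential u x := by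
  simp only [coulomb, potential, mul_div_assoc, integral_const_mul]

theorem coulomb_dilation {t : ℝ} (ht : 0 < t) (u : H1) :
    coulomb (dilation ht u) = t * coulomb u := by
  have h : ∀ᵐ x, ‖fn (dilation ht u) x‖ ^ 2 * potential (dilation ht u) x
      = t ^ 4 * (‖fn u (t • x)‖ ^ 2 * potential u (t • x)) := by
    filter_upwards [norm_sq_fn_dilation ht u] with x hx
    rw [hx, potential_dilation]
    ring
  rw [coulomb_eq, integral_congr_ae h, integral_const_mul,
    integral_comp_smul_three (fun x => ‖fn u x‖ ^ 2 * potential u x) ht, smul_eq_mul, coulomb_eq]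
  field_simp

theorem F_dilation {p t : ℝ} (ht : 0 < t) (u : H1) :
    F p (dilation ht u) = fiberF p (kinetic u) (coulomb u) (power p u) t := by
  rw [F, kinetic_dilation, coulomb_dilation, power_dilation, fiberF]

theorem Q_dilation {p t : ℝ} (ht : 0 < t) (u : H1) :
    Q p (dilation ht u) = fiberQ p (kinetic u) (coulomb u) (power p u) t := by
  rw [Q, kinetic_dilation, coulomb_dilation, power_dilation, fiberQ]

theorem F_eq_fiberF {p : ℝ} (u : H1) :
    F p u = fiberF p (kinetic u) (coulomb u) (power p u) 1 := by
  simp only [F, fiberF, one_pow, one_mul, Real.one_rpow]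

theorem Q_eq_fiberQ {p : ℝ} (u : H1) :
    Q p u = fiberQ p (kinetic u) (coulomb u) (power p u) 1 := by
  simp only [Q, fiberQ, one_pow, one_mul, Real.one_rpow]

theorem kinetic_nonneg (u : H1) : 0 ≤ kinetic u := integral_nonneg fun _ => by positivity

theorem coulomb_nonneg (u : H1) : 0 ≤ coulomb u :=
  integral_nonneg fun _ => integral_nonneg fun _ => by positivity

theorem power_nonneg (p : ℝ) (u : H1) : 0 ≤ power p u := integral_nonneg fun _ => by positivity

theorem power_pos {p : ℝ} (hp : 2 ≤ p) (hp6 : p ≤ 6) {u : H1} (hu : 0 < mass u) :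
    0 < power p u := by
  refine (power_nonneg p u).lt_of_ne fun h => hu.ne' ?_
  have h1 := (integral_eq_zero_iff_of_nonneg (fun x => by positivity)
    (integrable_norm_rpow hp hp6 u)).1 h.symm
  refine integral_eq_zero_of_ae ?_
  filter_upwards [h1] with x hx
  have := (Real.rpow_eq_zero (norm_nonneg _) (by linarith)).1 hx
  simp [this]

theorem mass_smul (t : ℝ) (u : H1) : mass (t • u) = t ^ 2 * mass u := by
  rw [mass_eq, mass_eq, show (t • u).1.fst = t • u.1.fst from rfl, norm_smul, mul_pow,
    Real.norm_eq_abs, sq_abs]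

theorem kinetic_smul (t : ℝ) (u : H1) : kinetic (t • u) = t ^ 2 * kinetic u := by
  rw [kinetic_eq, kinetic_eq, show (t • u).1.snd = t • u.1.snd from rfl, norm_smul, mul_pow,
    Real.norm_eq_abs, sq_abs]

/-! ### Competitors of mass at most `c` -/

/-- Projecting a competitor of the right mass on `V(c)` by a dilation. -/
theorem le_fiberF_of_mem_minimizers {p c t : ℝ} {u w : H1} (hu : u ∈ minimizers p c)
    (hw : mass w = c) (ht : 0 < t)
    (hq : fiberQ p (kinetic w) (coulomb w) (power p w) t = 0) :
    F p u ≤ fiberF p (kinetic w) (coulomb w) (power p w) t := by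
  rw [← F_dilation ht]
  exact hu.2 ⟨(mass_dilation ht w).trans hw, (Q_dilation ht w).trans hq⟩

/-- The mass of `w + a z` is quadratic in `a`. After possibly replacing `z` by `-z` the cross term
is nonnegative, so the mass at `a = 1` is at least `c` and the intermediate value theorem applies on
`[0, 1]`. Neither orthogonality nor disjoint supports are needed. -/
theorem exists_mass_add_smul_eq {c : ℝ} {w z : H1} (hw : mass w ≤ c) (hz : mass z = c) :
    ∃ a : ℝ, |a| ≤ 1 ∧ mass (w + a • z) = c := by
  have hw0 : 0 ≤ mass w := by rw [mass_eq]; positivity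
  have key : ∀ z : H1, mass z = c → 0 ≤ reInner w z → ∃ a : ℝ, |a| ≤ 1 ∧ mass (w + a • z) = c := by
    intro z hz hR
    have hm : ∀ a : ℝ, mass (w + a • z) = mass w + 2 * (a * reInner w z) + a ^ 2 * c := by
      intro a
      have : reInner w (a • z) = a * reInner w z := (reInnerCLM w).map_smul a z
      rw [mass_add, mass_smul, hz, this]
    have hcont : ContinuousOn (fun a : ℝ => mass (w + a • z)) (Set.Icc 0 1) := by
      simp only [hm]
      fun_prop
    obtain ⟨a, ha, h⟩ := intermediate_value_Icc zero_le_one hcont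
      (show c ∈ Set.Icc _ _ from ⟨by simpa using hw, by rw [hm]; linarith⟩)
    exact ⟨a, abs_le.2 ⟨by linarith [ha.1], ha.2⟩, h⟩
  rcases le_total 0 (reInner w z) with h | h
  · exact key z hz h
  · have hn : reInner w (-z) = - reInner w z := (reInnerCLM w).map_neg z
    obtain ⟨a, ha, h⟩ := key (-z) (by rw [← neg_one_smul ℝ z, mass_smul, hz]; ring) (by linarith)
    exact ⟨-a, by rwa [abs_neg], by rwa [smul_neg, ← neg_smul] at h⟩

theorem memLp_rpow {p : ℝ} (hp : 2 ≤ p) (hp6 : p ≤ 6) (u : H1) :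
    MemLp (fn u) (ENNReal.ofReal p) volume := by
  refine (integrable_norm_rpow_iff (stronglyMeasurable_fn u).aestronglyMeasurable
    (by simpa using by linarith) ENNReal.ofReal_ne_top).1 ?_
  rw [ENNReal.toReal_ofReal (by linarith)]
  exact SPS.integrable_norm_rpow hp hp6 u

theorem norm_toLp_rpow {p : ℝ} (hp : 2 ≤ p) (hp6 : p ≤ 6) (u : H1) :
    ‖(memLp_rpow hp hp6 u).toLp‖ = power p u ^ p⁻¹ := by
  rw [Lp.norm_toLp, (memLp_rpow hp hp6 u).eLpNorm_eq_integral_rpow_norm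
    (by simpa using by linarith) ENNReal.ofReal_ne_top,
    ENNReal.toReal_ofReal (by linarith : 0 ≤ p),
    ← power, ENNReal.toReal_ofReal (Real.rpow_nonneg (power_nonneg p u) _)]

/-- Continuity of the `Lᵖ` norm; `z` need not be small in `H¹`, since its mass may persist. -/
theorem tendsto_power_add {ι : Type*} {l : Filter ι} {p : ℝ} (hp : 2 ≤ p) (hp6 : p ≤ 6) (w : H1)
    {z : ι → H1} (hz : Tendsto (fun i => power p (z i)) l (𝓝 0)) :
    Tendsto (fun i => power p (w + z i)) l (𝓝 (power p w)) := by
  have hp0 : 0 < p := by linarith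
  have : Fact (1 ≤ ENNReal.ofReal p) := ⟨by
    rw [ENNReal.one_le_ofReal]; linarith⟩
  set T : H1 → Lp ℂ (ENNReal.ofReal p) (volume : Measure E3) := fun u =>
    (memLp_rpow hp hp6 u).toLp with hT
  have hpow : ∀ u, power p u = ‖T u‖ ^ p := fun u => by
    rw [hT]
    simp only
    rw [norm_toLp_rpow hp hp6, ← Real.rpow_mul (power_nonneg p u), inv_mul_cancel₀ hp0.ne',
      Real.rpow_one]
  have hadd : ∀ u v, T (u + v) = T u + T v := fun u v => by
    rw [hT]
    simp only
    rw [← MemLp.toLp_add]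
    exact MemLp.toLp_congr _ _ (fn_add u v)
  have h0 : Tendsto (fun i => T (z i)) l (𝓝 0) := by
    rw [tendsto_zero_iff_norm_tendsto_zero]
    have h1 := hz.rpow_const (p := p⁻¹) (Or.inr (by positivity))
    rw [Real.zero_rpow (by positivity)] at h1
    exact h1.congr fun i => (norm_toLp_rpow hp hp6 _).symm
  simp only [hpow, hadd]
  have h2 := (h0.const_add (T w)).norm.rpow_const (p := p) (Or.inr hp0.le)
  rwa [add_zero] at h2

theorem tendsto_kinetic_add {ι : Type*} {l : Filter ι} (w : H1)
    {z : ι → H1} (hz : Tendsto (fun i => kinetic (z i)) l (𝓝 0)) :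
    Tendsto (fun i => kinetic (w + z i)) l (𝓝 (kinetic w)) := by
  have h0 : Tendsto (fun i => (z i).1.snd) l (𝓝 0) := by
    rw [tendsto_zero_iff_norm_tendsto_zero]
    have h1 := hz.sqrt
    rw [Real.sqrt_zero] at h1
    refine h1.congr fun i => ?_
    rw [kinetic_eq, Real.sqrt_sq (norm_nonneg _)]
  have h2 := (h0.const_add w.1.snd).norm.pow 2
  rw [add_zero, ← kinetic_eq] at h2
  exact h2.congr fun i => (kinetic_eq _).symm

theorem tendsto_coulomb_add {ι : Type*} {l : Filter ι} (w : H1) {z : ι → H1} {M : ℝ} {τ : ι → ℝ}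
    (hτ0 : ∀ i, 0 < τ i) (hτ1 : ∀ i, τ i ≤ 1) (hτ : Tendsto τ l (𝓝 0))
    (hm : ∀ i, mass (z i) ≤ M) (hp : ∀ i x, potential (z i) x ≤ τ i ^ 2 * M) :
    Tendsto (fun i => coulomb (w + z i)) l (𝓝 (coulomb w)) := by
  obtain ⟨K, hK0, hK⟩ := exists_potential_le
  set L := max M (max (mass w) (K * ‖w‖ ^ 2)) with hL
  have h1 : M ≤ L := le_max_left _ _
  have h2 : mass w ≤ L := (le_max_left _ _).trans (le_max_right _ _)
  have h3 : K * ‖w‖ ^ 2 ≤ L := (le_max_right _ _).trans (le_max_right _ _)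
  have hbound : ∀ i, |coulomb (w + z i) - coulomb w|
      ≤ 8 * L ^ 2 * τ i + (3 * L ^ 2 * τ i ^ 2 + 12 * (2 * L) * L * τ i) := by
    intro i
    have hσ : ∫ x, |reMul w (z i) x| ≤ 2 * L := by
      have := integral_abs_reMul_le w (z i) one_pos
      rw [one_mul, inv_one, one_mul] at this
      linarith [hm i]
    have h := abs_coulomb_remainder_le w (z i) (L := L) (hτ0 i) (hτ1 i) h2 ((hm i).trans h1) hσ
      (fun x => (hK w x).trans h3)
      (fun x => (hp i x).trans (mul_le_mul_of_nonneg_left h1 (by positivity)))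
    rw [coulomb_add]
    obtain ⟨ha, hb⟩ := h
    rw [abs_le] at ha hb ⊢
    constructor <;> linarith [ha.1, ha.2, hb.1, hb.2]
  rw [tendsto_iff_norm_sub_tendsto_zero]
  refine squeeze_zero (fun i => norm_nonneg _) hbound ?_
  have : Tendsto (fun i => 8 * L ^ 2 * τ i + (3 * L ^ 2 * τ i ^ 2 + 12 * (2 * L) * L * τ i)) l
      (𝓝 (8 * L ^ 2 * 0 + (3 * L ^ 2 * 0 ^ 2 + 12 * (2 * L) * L * 0))) :=
    (hτ.const_mul _).add (((hτ.pow 2).const_mul _).add (hτ.const_mul _))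
  simpa using this

/-- Adding mass at infinity costs no energy: if `w` has less mass than a minimizer on `V(c)`,
then no dilation of `w` in `{Q = 0}` has smaller energy than the minimizer. -/
theorem le_fiberF_of_mass_le {p c t₀ : ℝ} (hp : 10 / 3 < p) (hp6 : p < 6) {u w : H1}
    (hu : u ∈ minimizers p c) (hw : mass w ≤ c) (hw0 : 0 < mass w) (ht₀ : 0 < t₀)
    (hq : fiberQ p (kinetic w) (coulomb w) (power p w) t₀ = 0) :
    F p u ≤ fiberF p (kinetic w) (coulomb w) (power p w) t₀ := by
  by_contra! hlt
  have hmu : mass u = c := hu.1.1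
  set ε : ℕ → ℝ := fun n => 1 / (n + 1) with hε
  have hε0 : ∀ n, 0 < ε n := fun n => by positivity
  have hε1 : ∀ n, ε n ≤ 1 := fun n => by
    rw [hε]; simp only
    rw [div_le_one (by positivity)]
    linarith [(Nat.cast_nonneg n : (0 : ℝ) ≤ n)]
  have hεt : Tendsto ε atTop (𝓝 0) := tendsto_one_div_add_atTop_nhds_zero_nat
  have hex : ∀ n, ∃ a : ℝ, |a| ≤ 1 ∧ mass (w + a • dilation (hε0 n) u) = c := fun n =>
    exists_mass_add_smul_eq hw ((mass_dilation _ u).trans hmu)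
  choose a ha hac using hex
  -- The correction that fills the missing mass. Since `|a n| ≤ 1`, its kinetic term is at most of
  -- order `ε²`, its power term of order `ε^{3(p-2)/2}` and its potential of order `ε`, so all
  -- coefficients of `w + z n` tend to those of `w`.
  set z : ℕ → H1 := fun n => a n • dilation (hε0 n) u with hz
  have ha2 : ∀ n, a n ^ 2 ≤ 1 := fun n => (sq_le_one_iff_abs_le_one _).2 (ha n)
  have hA : Tendsto (fun n => kinetic (w + z n)) atTop (𝓝 (kinetic w)) := by
    refine tendsto_kinetic_add w (squeeze_zero (fun n => kinetic_nonneg _)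
      (g := fun n => ε n ^ 2 * kinetic u) (fun n => ?_) ?_)
    · rw [hz, kinetic_smul, kinetic_dilation]
      exact mul_le_of_le_one_left (mul_nonneg (by positivity) (kinetic_nonneg u)) (ha2 n)
    · simpa using (hεt.pow 2).mul_const (kinetic u)
  have hC : Tendsto (fun n => power p (w + z n)) atTop (𝓝 (power p w)) := by
    refine tendsto_power_add (by linarith) hp6.le w (squeeze_zero (fun n => power_nonneg p _)
      (g := fun n => ε n ^ (3 * (p - 2) / 2) * power p u) (fun n => ?_) ?_)
    · have e : power p (z n) = |a n| ^ p * power p (dilation (hε0 n) u) := by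
        rw [power, power, ← integral_const_mul]
        refine integral_congr_ae ?_
        filter_upwards [fn_real_smul (a n) (dilation (hε0 n) u)] with x hx
        rw [hx, norm_mul, Complex.norm_real, Real.norm_eq_abs,
          Real.mul_rpow (abs_nonneg _) (norm_nonneg _)]
      rw [e, power_dilation]
      exact mul_le_of_le_one_left (mul_nonneg (Real.rpow_nonneg (hε0 n).le _) (power_nonneg p u))
        (Real.rpow_le_one (abs_nonneg _) (ha n) (by linarith))
    · have h := (hεt.rpow_const (p := 3 * (p - 2) / 2) (Or.inr (by linarith))).mul_const (power p u)
      rwa [Real.zero_rpow (by linarith), zero_mul] at h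
  have hB : Tendsto (fun n => coulomb (w + z n)) atTop (𝓝 (coulomb w)) := by
    obtain ⟨K, hK0, hK⟩ := exists_potential_le
    -- The potential of `z n` is `O(ε n)` and has to be at most `τ² M`, hence `τ = √ε`.
    refine tendsto_coulomb_add w (M := max c (K * ‖u‖ ^ 2)) (τ := fun n => √(ε n))
      (fun n => Real.sqrt_pos.2 (hε0 n)) (fun n => Real.sqrt_le_one.2 (hε1 n)) ?_ (fun n => ?_)
      fun n x => ?_
    · simpa using hεt.sqrt
    · rw [hz, mass_smul, mass_dilation, hmu]
      refine (mul_le_of_le_one_left ?_ (ha2 n)).trans (le_max_left _ _)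
      rw [← hmu, mass_eq]; positivity
    · rw [hz, potential_smul, potential_dilation, Real.sq_sqrt (hε0 n).le]
      refine (mul_le_of_le_one_left (mul_nonneg (hε0 n).le (potential_nonneg _ _)) (ha2 n)).trans ?_
      exact mul_le_mul_of_nonneg_left ((hK u _).trans (le_max_right _ _)) (hε0 n).le
  have hcont : ContinuousAt (fun P : (ℝ × ℝ × ℝ) × ℝ => fiberF p P.1.1 P.1.2.1 P.1.2.2 P.2)
      ((kinetic w, coulomb w, power p w), t₀) := by
    unfold fiberF
    have : ContinuousAt (fun P : (ℝ × ℝ × ℝ) × ℝ => P.2 ^ (3 * (p - 2) / 2))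
        ((kinetic w, coulomb w, power p w), t₀) :=
      continuousAt_snd.rpow_const (Or.inl ht₀.ne')
    fun_prop
  have hev := hcont.eventually_lt_const hlt
  rw [nhds_prod_eq, eventually_prod_iff] at hev
  obtain ⟨pa, hpa, pb, hpb, hab⟩ := hev
  obtain ⟨δ, hδ, hball⟩ := Metric.eventually_nhds_iff.1 hpb
  -- Stability of the root puts a dilation of `w + z n`, of mass exactly `c`, on `Q = 0` with energy
  -- still below `F p u`.
  have hroot := eventually_exists_fiberQ_eq_zero hp (coulomb_nonneg w)
    (power_pos (by linarith) hp6.le hw0) ht₀ hδ hq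
  have htend := hA.prodMk_nhds (hB.prodMk_nhds hC)
  obtain ⟨n, h1, t, ht, htδ, hqt⟩ :=
    ((htend.eventually hpa).and (htend.eventually hroot)).exists
  have h2 := hab h1 (hball (by rwa [Real.dist_eq]) : pb t)
  exact (le_fiberF_of_mem_minimizers hu (hac n) ht hqt).not_gt h2

/-! ### First-order conditions and the multiplier -/

/-- Along a curve whose masses do not exceed `c`, the energy of a minimizer on `V(c)` does not
decrease to first order. -/
theorem energyDeriv_nonneg {p c : ℝ} (hp : 10 / 3 < p) (hp6 : p < 6) (hc : 0 < c) {u v : H1}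
    (hu : u ∈ minimizers p c) {γ : ℝ → H1} (hγ : HasDerivAt γ v 0) (hγ0 : γ 0 = u)
    (hm : ∀ᶠ s in 𝓝[>] (0 : ℝ), 0 < mass (γ s) ∧ mass (γ s) ≤ c) :
    0 ≤ energyDeriv (by linarith) hp6.le u v := by
  by_contra! hlt
  have hp3 : 3 ≤ p := by linarith
  have hcomp : ∀ {f : H1 → ℝ} {L : H1 →L[ℝ] ℝ}, HasFDerivAt f L u →
      HasDerivAt (fun s => f (γ s)) (L v) 0 := fun hf => by
    subst hγ0
    exact hf.comp_hasDerivAt 0 hγ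
  have hA : HasDerivAt (fun s => kinetic (γ s)) (((2 : ℝ) • gradInnerCLM u) v) 0 :=
    hcomp (hasFDerivAt_kinetic u)
  have hB : HasDerivAt (fun s => coulomb (γ s)) (((4 : ℝ) • potentialCLM u) v) 0 :=
    hcomp (hasFDerivAt_coulomb u)
  have hC : HasDerivAt (fun s => power p (γ s)) ((p • powerCLM (by linarith) hp6.le u) v) 0 :=
    hcomp (hasFDerivAt_power hp3 hp6.le u)
  have hmu : mass u = c := hu.1.1
  have hev := eventually_exists_fiberF_lt hp hA hB hC (kinetic_nonneg _) (coulomb_nonneg _)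
    (by rw [hγ0]; exact power_pos (by linarith) hp6.le (hmu ▸ hc))
    (by rw [hγ0, ← Q_eq_fiberQ]; exact hu.1.2) (by
      refine lt_of_eq_of_lt ?_ hlt
      simp only [energyDeriv, sub_apply, add_apply, smul_apply, smul_eq_mul]
      field_simp)
  obtain ⟨s, ⟨hs0, hs⟩, t, ht, hq, hFt⟩ := (hm.and hev).exists
  rw [hγ0, ← F_eq_fiberF] at hFt
  exact (le_fiberF_of_mass_le hp hp6 hu hs hs0 ht hq).not_gt hFt

/-- By orthogonality `u + s v` has mass `c + s² mass v`. The normalizing factor is therefore even in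
`s`, and the normalized curve still has velocity `v` at `0`. -/
theorem energyDeriv_nonneg_of_reInner_eq_zero {p c : ℝ} (hp : 10 / 3 < p) (hp6 : p < 6)
    (hc : 0 < c) {u v : H1} (hu : u ∈ minimizers p c) (hv : reInner u v = 0) :
    0 ≤ energyDeriv (by linarith) hp6.le u v := by
  have hmu : mass u = c := hu.1.1
  have hmv : 0 ≤ mass v := by rw [mass_eq]; positivity
  have hpos : ∀ s : ℝ, 0 < c + s ^ 2 * mass v := fun s => by positivity
  have h1 : HasDerivAt (fun s : ℝ => c / (c + s ^ 2 * mass v)) 0 0 := by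
    have hd : HasDerivAt (fun s : ℝ => c + s ^ 2 * mass v) 0 0 := by
      simpa using ((hasDerivAt_pow 2 (0 : ℝ)).mul_const (mass v)).const_add c
    have := (hasDerivAt_const (0 : ℝ) c).div hd (hpos 0).ne'
    simp only [mul_zero, zero_mul, sub_zero, zero_div] at this
    exact this
  have h2 : HasDerivAt (fun s : ℝ => √(c / (c + s ^ 2 * mass v))) 0 0 := by
    simpa using h1.sqrt (by simpa using hc.ne')
  have h3 : HasDerivAt (fun s : ℝ => u + s • v) v 0 := by
    simpa using ((hasDerivAt_id (0 : ℝ)).smul_const v).const_add u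
  have h4 : HasDerivAt (fun s : ℝ => √(c / (c + s ^ 2 * mass v)) • (u + s • v)) v 0 := by
    have := h2.smul h3
    simp only [ne_eq, OfNat.ofNat_ne_zero, not_false_eq_true, zero_pow, zero_mul, add_zero,
      div_self hc.ne', Real.sqrt_one, one_smul, zero_smul] at this
    exact this
  refine energyDeriv_nonneg hp hp6 hc hu
    (γ := fun s => √(c / (c + s ^ 2 * mass v)) • (u + s • v)) h4 ?_ ?_
  · simp [div_self hc.ne']
  · refine Eventually.of_forall fun s => ?_
    have : mass (√(c / (c + s ^ 2 * mass v)) • (u + s • v)) = c := by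
      have e : reInner u (s • v) = 0 := by
        rw [← reInnerCLM_apply, map_smul, reInnerCLM_apply, hv, smul_zero]
      rw [mass_smul, mass_add, e, mass_smul, hmu, Real.sq_sqrt (div_nonneg hc.le (hpos s).le),
        mul_zero, add_zero, div_mul_cancel₀ _ (hpos s).ne']
    rw [this]
    exact ⟨hc, le_rfl⟩

/-- This decides the sign of the multiplier: `(1 - s) u` only loses mass, so `-u` is an admissible
direction. -/
theorem energyDeriv_self_nonpos {p c : ℝ} (hp : 10 / 3 < p) (hp6 : p < 6)
    (hc : 0 < c) {u : H1} (hu : u ∈ minimizers p c) :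
    energyDeriv (by linarith) hp6.le u u ≤ 0 := by
  have hmu : mass u = c := hu.1.1
  have h := energyDeriv_nonneg hp hp6 hc hu (v := -u) (γ := fun s => (1 - s) • u)
    (by simpa using ((hasDerivAt_id (0 : ℝ)).const_sub 1).smul_const u) (by simp) (by
      filter_upwards [Ioo_mem_nhdsGT (one_pos : (0 : ℝ) < 1)] with s hs
      have h1 : 0 < 1 - s := by linarith [hs.2]
      rw [mass_smul, hmu]
      exact ⟨by positivity, mul_le_of_le_one_left hc.le (by nlinarith [hs.1])⟩)
  rw [map_neg] at h
  linarith

theorem reInner_self (u : H1) : reInner u u = mass u := by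
  rw [reInner_eq]
  simp only [reMul_self]
  rfl

/-- On the tangent space, `v` and `-v` are both admissible, so the derivative vanishes there.
Subtracting from a general `v` its component along `u` identifies the multiplier. -/
theorem energyDeriv_eq_mul_reInner {p c : ℝ} (hp : 10 / 3 < p) (hp6 : p < 6)
    (hc : 0 < c) {u : H1} (hu : u ∈ minimizers p c) (v : H1) :
    energyDeriv (by linarith) hp6.le u v
      = energyDeriv (by linarith) hp6.le u u / c * reInner u v := by
  have hmu : mass u = c := hu.1.1
  have key : ∀ v : H1, reInner u v = 0 → energyDeriv (by linarith) hp6.le u v = 0 := by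
    intro v hv
    have h1 := energyDeriv_nonneg_of_reInner_eq_zero hp hp6 hc hu hv
    have h2 := energyDeriv_nonneg_of_reInner_eq_zero hp hp6 hc hu (v := -v) (by
      rw [← reInnerCLM_apply, map_neg, reInnerCLM_apply, hv, neg_zero])
    rw [map_neg] at h2
    linarith
  have h := key (v - (reInner u v / c) • u) (by
    rw [← reInnerCLM_apply, map_sub, map_smul, reInnerCLM_apply, reInnerCLM_apply, reInner_self,
      hmu, smul_eq_mul, div_mul_cancel₀ _ hc.ne', sub_self])
  rw [map_sub, map_smul, smul_eq_mul] at h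
  rw [sub_eq_zero.1 h]
  ring

theorem integral_mul_conj_I_smul {w : E3 → ℂ} (v : H1) :
    ∫ x, w x * conj (fn (Complex.I • v) x) = -Complex.I * ∫ x, w x * conj (fn v x) := by
  rw [← integral_const_mul]
  refine integral_congr_ae ?_
  filter_upwards [fn_smul Complex.I v] with x hx
  rw [hx, map_mul, Complex.conj_I]
  ring

theorem gradInner_I_smul (u v : H1) :
    gradInner u (Complex.I • v) = -Complex.I * gradInner u v := by
  rw [gradInner_eq, gradInner_eq, show (Complex.I • v).1.snd = Complex.I • v.1.snd from rfl,
    inner_smul_left, Complex.conj_I]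

/-- The hypothesis is the real part of the equation. The complex form is conjugate-linear in `v`, so
testing with `i v` gives the imaginary part. -/
theorem isWeakSolution_of_energyDeriv_eq {p l : ℝ} (hp : 2 < p) (hp6 : p ≤ 6) {u : H1}
    (h : ∀ v, energyDeriv hp hp6 u v = l * reInner u v) : IsWeakSolution p u l := by
  intro v
  refine ⟨integrable_grad_mul_conj u v, integrable_fn_mul_conj u v, integrable_potential_mul u v,
    integrable_power_term hp hp6 u v, ?_⟩
  set W : H1 → ℂ := fun v => gradInner u v - (l : ℂ) * (∫ x, fn u x * conj (fn v x))
      + (∫ x, (potential u x : ℂ) * fn u x * conj (fn v x))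
      - (∫ x, ((‖fn u x‖ ^ (p - 2) : ℝ) : ℂ) * fn u x * conj (fn v x)) with hW
  have hre : ∀ v, (W v).re = 0 := by
    intro v
    have := h v
    simp only [energyDeriv, sub_apply, add_apply, gradInnerCLM_apply, potentialCLM_apply,
      powerCLM_apply, reInner] at this
    simp only [hW, Complex.sub_re, Complex.add_re, Complex.re_ofReal_mul]
    linarith
  have hI : W (Complex.I • v) = -Complex.I * W v := by
    simp only [hW, gradInner_I_smul, integral_mul_conj_I_smul]
    ring
  have him := hre (Complex.I • v)
  rw [hI] at him
  change W v = 0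
  exact Complex.ext (hre v) (by simpa using him)

end SPS

theorem theorem1p4 (p : ℝ) (hp : 10 / 3 < p) (hp6 : p < 6) (c : ℝ) (hc : 0 < c)
    (u : SPS.H1) (hu : u ∈ SPS.minimizers p c) :
    SPS.IsConstrainedCriticalPoint p c u ∧
      ∃ l : ℝ, l ≤ 0 ∧ SPS.IsLagrangeMultiplier p u l ∧ SPS.IsWeakSolution p u l := by
  have hF := SPS.hasFDerivAt_F (by linarith : 3 ≤ p) hp6.le u
  have hL := SPS.energyDeriv_eq_mul_reInner hp hp6 hc hu
  refine ⟨⟨hu.1.1, hF.differentiableAt, fun v hv => ?_⟩, _,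
    div_nonpos_of_nonpos_of_nonneg (SPS.energyDeriv_self_nonpos hp hp6 hc hu) hc.le,
    ⟨hF.differentiableAt, fun v => ?_⟩,
    SPS.isWeakSolution_of_energyDeriv_eq (by linarith) hp6.le hL⟩
  · rw [hF.fderiv, hL, hv, mul_zero]
  · rw [hF.fderiv, hL]
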